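/- Let $\mathcal X$ be a compact metric space, let $K$ be a Mercer kernel on $\mathcal X$ (continuous, symmetric, positive semidefinite) with reproducing kernel Hilbert space $(\mathcal H_K,\|\cdot\|_K)$, and let $\rho$ be a Borel probability measure on $\mathcal X\times\mathbb R$ with marginal $\rho_X$ on $\mathcal X$, conditional distributions $\rho(\cdot|x)$ and regression function $f_\rho(x)=\int y\,d\rho(y|x)$. Write $\|\cdot\|_\rho$ for the norm of $L^2_{\rho_X}$, and let $L_K$ be the compact positive operator on $L^2_{\rho_X}$ given by $L_Kf=\int_{\mathcal X}K(\cdot,x)f(x)\,d\rho_X(x)$. Assume: (1) there is $M>0$ with $|y|\le M$ $\rho$-almost surely; (2) $f_\rho=L_K^rh_\rho$ in $L^2_{\rho_X}$ for some $h_\rho\in L^2_{\rho_X}$ and some $\frac12\le r\le 1$; (3) $\mathrm{Tr}\big((\lambda I+L_K)^{-1}L_K\big)\le C_0\lambda^{-s}$ for all $\lambda>0$, with some $0<s\le1$ and $C_0\ge1$. Let $D_1,\dots,D_m$ ($m\ge1$) be samples of sizes $|D_j|\ge1$, and $|D|=\sum_{j=1}^m|D_j|$, where all $|D|$ points are drawn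 independently from $\rho$. For $\lambda_1,\dots,\lambda_m>0$ put $$f_{D_j,\lambda_j}=\arg\min_{f\in\mathcal H_K}\Big\{\frac1{|D_j|}\sum_{(x,y)\in D_j}(f(x)-y)^2+\lambda_j\|f\|_K^2\Big\},\qquad \overline f_{D,\vec\lambda}=\sum_{j=1}^m\frac{|D_j|}{|D|}f_{D_j,\lambda_j}.$$ Then for every constant $C_1>0$ there is a constant $C_2>0$, independent of $m$, of $|D|$ and of the sizes $|D_j|$, such that, whenever $$|D_j|\ge|D|^{\frac1{2r+s}}\log^4|D|\quad\text{and}\quad\lambda_j=C_1|D|^{-\frac1{2r+s}}\quad(j=1,\dots,m),\qquad m\le|D|^{\frac{2r+s-1}{2r+s}}\log^{-4}|D|$$ (the last condition being read as $m\log^4|D|\le|D|^{\frac{2r+s-1}{2r+s}}$), the random variable $\|\overline f_{D,\vec\lambda}-f_\rho\|_\rho^2$ is integrable and $$E\big[\|\overline f_{D,\vec\lambda}-f_\rho\|_\rho^2\big]\le C_2|D|^{-\frac{2r}{2r+s}}.$$ -/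

import Mathlib

open MeasureTheory ProbabilityTheory
open scoped ENNReal RealInnerProductSpace

namespace DKRR

section Operators

variable {E : Type*} [NormedAddCommGroup E] [InnerProductSpace ℝ E] [CompleteSpace E]

/-- The `r`-th power `A ^ r` (`r > 0`) of a compact, self-adjoint, positive operator `A` on a real
Hilbert space, by its spectral decomposition: `A ^ r h = ∑_μ μ ^ r P_μ h`, where `P_μ` is the
orthogonal projection onto the eigenspace `ker (A - μ I)`; `P_μ = 0` unless `μ` is an
eigenvalue. -/
noncomputable def spectralPow (A : E →L[ℝ] E) (r : ℝ) (h : E) : E :=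
  ∑' μ : ℝ, μ ^ r • (A - μ • ContinuousLinearMap.id ℝ E).ker.starProjection h

/-- The trace, in `[0, ∞]`, of a positive operator `A` on a real Hilbert space: the supremum of
`∑ ⟪A e, e⟫` over finite orthonormal families. For a positive operator this is the sum of
`⟪A e, e⟫` over any orthonormal basis. -/
noncomputable def posTrace (A : E →L[ℝ] E) : ℝ≥0∞ :=
  ⨆ (s : Finset E) (_ : Orthonormal ℝ (fun e : s => (e : E))),
    ∑ e ∈ s, ENNReal.ofReal ⟪A e, e⟫

/-- The effective dimension `Tr ((l I + A)⁻¹ A)` of a positive operator `A`, for `l > 0`. -/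
noncomputable def effectiveDimension (A : E →L[ℝ] E) (l : ℝ) : ℝ≥0∞ :=
  posTrace (Ring.inverse (l • ContinuousLinearMap.id ℝ E + A) ∘L A)

end Operators

section IntegralOperator

variable {X : Type*} [MetricSpace X] [CompactSpace X] [MeasurableSpace X] [BorelSpace X]
  (μ : Measure X) [IsFiniteMeasure μ] {K : X → X → ℝ}

theorem kernelIntegral_memLp_and_bound (hK : Continuous (Function.uncurry K)) :
    ∃ C : ℝ, ∀ f : Lp ℝ 2 μ, ∃ h : MemLp (fun x => ∫ t, K x t * f t ∂μ) 2 μ,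
      ‖h.toLp‖ ≤ C * ‖f‖ := by
  obtain ⟨B, hB⟩ : ∃ B : ℝ, ∀ p : X × X, ‖Function.uncurry K p‖ ≤ B := by
    obtain ⟨B, hB⟩ := isCompact_univ.exists_bound_of_continuousOn hK.continuousOn
    exact ⟨B, fun p => hB p (Set.mem_univ p)⟩
  set B' := max B 0 with hB'
  have hKB : ∀ x t, ‖K x t‖ ≤ B' := fun x t => (hB (x, t)).trans (le_max_left _ _)
  set w : ℝ := μ.real Set.univ ^ (2 : ℝ≥0∞).toReal⁻¹
  have hw : 0 ≤ w := by positivity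
  refine ⟨w * (B' * w), fun f => ?_⟩
  have hf1 : Integrable f μ := (Lp.memLp f).integrable (by norm_num)
  have hL1 : ∫ t, ‖f t‖ ∂μ ≤ w * ‖f‖ := by
    have h1 := eLpNorm_le_eLpNorm_mul_rpow_measure_univ (μ := μ) (p := 1) (q := 2)
      (by norm_num) (Lp.aestronglyMeasurable f)
    have h2 : ∫ t, ‖f t‖ ∂μ = (eLpNorm f 1 μ).toReal := by
      rw [eLpNorm_one_eq_lintegral_enorm, integral_norm_eq_lintegral_enorm
        (Lp.aestronglyMeasurable f)]
    rw [h2, Lp.norm_def]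
    have h3 : (eLpNorm f 2 μ * μ Set.univ ^ (1 / (1 : ℝ≥0∞).toReal - 1 / (2 : ℝ≥0∞).toReal)) ≠ ∞ :=
      ENNReal.mul_ne_top (Lp.eLpNorm_ne_top f)
        (ENNReal.rpow_ne_top_of_nonneg (by norm_num) (measure_ne_top _ _))
    refine (ENNReal.toReal_mono h3 h1).trans (le_of_eq ?_)
    rw [ENNReal.toReal_mul, ← ENNReal.toReal_rpow, mul_comm]
    simp only [w, Measure.real]
    norm_num
  have hbound : ∀ x, ‖∫ t, K x t * f t ∂μ‖ ≤ B' * w * ‖f‖ := by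
    intro x
    calc ‖∫ t, K x t * f t ∂μ‖ ≤ ∫ t, B' * ‖f t‖ ∂μ := by
          refine norm_integral_le_of_norm_le (hf1.norm.const_mul B') (.of_forall fun t => ?_)
          rw [norm_mul]
          exact mul_le_mul_of_nonneg_right (hKB x t) (norm_nonneg _)
      _ = B' * ∫ t, ‖f t‖ ∂μ := integral_const_mul _ _
      _ ≤ B' * (w * ‖f‖) := mul_le_mul_of_nonneg_left hL1 (le_max_right _ _)
      _ = B' * w * ‖f‖ := by ring
  have hm : AEStronglyMeasurable (fun x => ∫ t, K x t * f t ∂μ) μ := by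
    have h1 : StronglyMeasurable (fun p : X × X => K p.1 p.2 * f p.2) :=
      hK.stronglyMeasurable.mul ((Lp.stronglyMeasurable f).comp_measurable measurable_snd)
    exact h1.integral_prod_right.aestronglyMeasurable
  have hmem : MemLp (fun x => ∫ t, K x t * f t ∂μ) 2 μ :=
    MemLp.of_bound hm _ (.of_forall hbound)
  refine ⟨hmem, ?_⟩
  have h := Lp.norm_le_of_ae_bound (p := 2) (f := hmem.toLp)
    (C := B' * w * ‖f‖) (by positivity) (by
      filter_upwards [hmem.coeFn_toLp] with x hx
      rw [hx]; exact hbound x)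
  calc ‖hmem.toLp‖ ≤ _ := h
    _ = w * (B' * w) * ‖f‖ := by
        have : (measureUnivNNReal μ : ℝ) = μ.real Set.univ := rfl
        rw [this]
        ring

/-- The integral operator `L_K : L²(μ) → L²(μ)`, `(L_K f)(x) = ∫ K(x, t) f(t) dμ(t)`, of a
continuous kernel on a compact metric space. -/
noncomputable def integralOperator (hK : Continuous (Function.uncurry K)) :
    Lp ℝ 2 μ →L[ℝ] Lp ℝ 2 μ :=
  LinearMap.mkContinuousOfExistsBound
    { toFun := fun f =>
        ((kernelIntegral_memLp_and_bound μ hK).choose_spec f).choose.toLp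
          (fun x => ∫ t, K x t * f t ∂μ)
      map_add' := by
        intro f g
        rw [← MemLp.toLp_add]
        refine (MemLp.toLp_eq_toLp_iff _ _).2 (.of_forall fun x => ?_)
        have hi : ∀ f : Lp ℝ 2 μ, Integrable (fun t => K x t * f t) μ := fun f => by
          obtain ⟨B, hB⟩ := isCompact_univ.exists_bound_of_continuousOn
            (hK.comp (Continuous.prodMk_right x)).continuousOn
          exact ((Lp.memLp f).integrable (by norm_num)).bdd_mul (c := B)
            (hK.comp (Continuous.prodMk_right x)).aestronglyMeasurable
            (.of_forall fun t => hB t (Set.mem_univ t))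
        rw [Pi.add_apply, ← integral_add (hi f) (hi g)]
        refine integral_congr_ae ?_
        filter_upwards [Lp.coeFn_add f g] with t ht
        rw [ht, Pi.add_apply, mul_add]
      map_smul' := by
        intro c f
        rw [RingHom.id_apply, ← MemLp.toLp_const_smul]
        refine (MemLp.toLp_eq_toLp_iff _ _).2 (.of_forall fun x => ?_)
        rw [Pi.smul_apply, smul_eq_mul, ← integral_const_mul]
        refine integral_congr_ae ?_
        filter_upwards [Lp.coeFn_smul c f] with t ht
        rw [ht, Pi.smul_apply, smul_eq_mul]
        ring }
    ⟨_, fun f => ((kernelIntegral_memLp_and_bound μ hK).choose_spec f).choose_spec⟩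

theorem integralOperator_ae_eq (hK : Continuous (Function.uncurry K)) (f : Lp ℝ 2 μ) :
    integralOperator μ hK f =ᵐ[μ] fun x => ∫ t, K x t * f t ∂μ :=
  ((kernelIntegral_memLp_and_bound μ hK).choose_spec f).choose.coeFn_toLp

end IntegralOperator

section Learning

variable {X : Type*}

/-- The regression function `f_ρ(x) = E[y | X = x] = ∫ y dρ(y | x)`. -/
noncomputable def regressionFunction [MeasurableSpace X] (ρ : Measure (X × ℝ))
    [IsFiniteMeasure ρ] (x : X) : ℝ :=
  ∫ y, y ∂(ρ.condKernel x)

variable (H : Type*) [NormedAddCommGroup H] [InnerProductSpace ℝ H] [CompleteSpace H]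
  [RKHS ℝ H X ℝ]

/-- The real-valued reproducing kernel `K(x, t)` of the space `H`. -/
noncomputable def reproducingKernel (x t : X) : ℝ := RKHS.kernel H x t 1

variable {H}

/-- The regularized empirical risk `(1/n) ∑ (f(x_i) - y_i)² + l ‖f‖²`. -/
noncomputable def krrObjective {n : ℕ} (D : Fin n → X × ℝ) (l : ℝ) (f : H) : ℝ :=
  (1 / n : ℝ) * ∑ i, (f (D i).1 - (D i).2) ^ 2 + l * ‖f‖ ^ 2

variable (H)

/-- The kernel ridge regression estimator: the minimizer over `H` of the regularized empirical
risk (it exists and is unique for every sample if `l > 0`). -/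
noncomputable def krr {n : ℕ} (D : Fin n → X × ℝ) (l : ℝ) : H :=
  Classical.epsilon fun f : H => ∀ g : H, krrObjective D l f ≤ krrObjective D l g

variable {H} in
theorem existsUnique_krrObjective_min {n : ℕ} (D : Fin n → X × ℝ) {l : ℝ} (hl : 0 < l) :
    ∃! f : H, ∀ g : H, krrObjective D l f ≤ krrObjective D l g := by
  let ev : Fin n → H →L[ℝ] ℝ := fun i => (ContinuousLinearMap.proj (D i).1) ∘L RKHS.coeCLM ℝ
  have hev : ∀ i (f : H), ev i f = f (D i).1 := fun i f => rfl
  let ip : H →L[ℝ] H →L[ℝ] ℝ := innerSL ℝ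
  let B : H →L[ℝ] H →L[ℝ] ℝ := l • ip + (1 / n : ℝ) • ∑ i, (ev i).smulRight (ev i)
  have hB : ∀ f g : H, B f g = l * ⟪f, g⟫ + (1 / n : ℝ) * ∑ i, f (D i).1 * g (D i).1 := by
    intro f g
    simp [B, ip, hev]
    exact Or.inl rfl
  have hBpos : ∀ f : H, l * ‖f‖ ^ 2 ≤ B f f := by
    intro f
    rw [hB, real_inner_self_eq_norm_sq]
    have : 0 ≤ (1 / n : ℝ) * ∑ i, f (D i).1 * f (D i).1 :=
      mul_nonneg (by positivity) (Finset.sum_nonneg fun i _ => mul_self_nonneg _)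
    linarith
  have hco : IsCoercive B := ⟨l, hl, fun f => by have := hBpos f; nlinarith⟩
  let ℓ : H →L[ℝ] ℝ := (1 / n : ℝ) • ∑ i, (D i).2 • ev i
  have hℓ : ∀ g : H, ℓ g = (1 / n : ℝ) * ∑ i, (D i).2 * g (D i).1 := by
    intro g
    simp [ℓ, hev]
  let f₀ : H := hco.continuousLinearEquivOfBilin.symm ((InnerProductSpace.toDual ℝ H).symm ℓ)
  have hf₀ : ∀ g : H, B f₀ g = ℓ g := by
    intro g
    rw [← hco.continuousLinearEquivOfBilin_apply]
    simp [f₀]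
  have key : ∀ g : H, krrObjective D l g = krrObjective D l f₀ + B (g - f₀) (g - f₀) := by
    intro g
    have h1 := hf₀ (g - f₀)
    have hg : g = f₀ + (g - f₀) := by abel
    set d := g - f₀
    rw [hg]
    rw [hB, hℓ] at h1
    rw [hB]
    unfold krrObjective
    rw [norm_add_sq_real, real_inner_self_eq_norm_sq]
    have h2 : ∑ i, ((f₀ + d) (D i).1 - (D i).2) ^ 2 = ∑ i, (f₀ (D i).1 - (D i).2) ^ 2
        + 2 * ∑ i, f₀ (D i).1 * d (D i).1 - 2 * ∑ i, (D i).2 * d (D i).1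
        + ∑ i, d (D i).1 * d (D i).1 := by
      rw [Finset.mul_sum, Finset.mul_sum, ← Finset.sum_add_distrib, ← Finset.sum_sub_distrib,
        ← Finset.sum_add_distrib]
      refine Finset.sum_congr rfl fun i _ => ?_
      rw [RKHS.coe_add, Pi.add_apply]
      ring
    rw [h2]
    linear_combination 2 * h1
  refine ⟨f₀, fun g => ?_, fun g hg => ?_⟩
  · have := hBpos (g - f₀)
    have h0 : 0 ≤ l * ‖g - f₀‖ ^ 2 := by positivity
    change krrObjective D l f₀ ≤ krrObjective D l g
    rw [key g]; linarith
  · have h1 := hg f₀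
    have h2 := hBpos (g - f₀)
    rw [key g] at h1
    have h3 : ‖g - f₀‖ ^ 2 ≤ 0 := by nlinarith [sq_nonneg ‖g - f₀‖]
    have h4 : ‖g - f₀‖ = 0 := by nlinarith [norm_nonneg (g - f₀)]
    exact sub_eq_zero.1 (norm_eq_zero.1 h4)

theorem krr_spec {n : ℕ} (D : Fin n → X × ℝ) {l : ℝ} (hl : 0 < l) (g : H) :
    krrObjective D l (krr H D l) ≤ krrObjective D l g :=
  Classical.epsilon_spec (existsUnique_krrObjective_min (H := H) D hl).exists g

/-- Distributed kernel ridge regression on `m` machines, the `j`-th of which holds the sample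
`i ↦ D ⟨j, i⟩` of size `n j` and uses the regularization parameter `l j`: the average of the local
estimators with weights `|D_j| / |D|`. -/
noncomputable def dkrr {m : ℕ} {n : Fin m → ℕ} (D : (Σ j : Fin m, Fin (n j)) → X × ℝ)
    (l : Fin m → ℝ) : H :=
  ∑ j, ((n j : ℝ) / (∑ k, n k : ℕ)) • krr H (fun i => D ⟨j, i⟩) (l j)

/-- The excess generalization error `‖f - f_ρ‖²` in `L²(ρ_X)`, where `ρ_X` is the marginal of
`ρ` on `X`. -/
noncomputable def excessError [MeasurableSpace X] (ρ : Measure (X × ℝ)) [IsFiniteMeasure ρ]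
    (f : X → ℝ) : ℝ :=
  ∫ x, (f x - regressionFunction ρ x) ^ 2 ∂ρ.fst

end Learning

end DKRR

/-!
The expected error is bounded directly, by exchangeability of the sample points; no concentration
inequality for random operators is needed.

Let `S : H → L²(ρ_X)` be the inclusion, so that `L_K = S S†`, and for a sample `D` of size `n` let
`R_D = (n l I + ∑ i, K_{x_i} ⊗ K_{x_i})⁻¹`. Adding an independent test point to the sample changes
`R_D` by a rank-one update, whose effect is a factor at most `c = 1 + κ² / (n l)`, and afterwards the
test point can be exchanged with each sample point. This gives, for every `f` in `H`,

  `n E ‖S R_D f‖² ≤ c² E ⟪f, R_D f⟫`   (`card_mul_integral_sampleInv_sq_le`).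

If `f = S† h`, the form `⟪f, R_D f⟫ = ⟪h, S R_D f⟫` is at most `‖h‖ ‖S R_D f‖`, so the inequality
bounds its mean `a` by a multiple of `√a`, and hence `n a ≤ c² ‖h‖²`
(`card_mul_integral_inner_sampleInv_le`).

* Bias. The regression function `L_K ^ r h` is `S (f + S† g)` with `‖f‖ ≤ l ^ (r - 1/2) ‖h‖` and
  `‖g‖ ≤ l ^ (r - 1) ‖h‖` (`exists_spectralPow_eq_split`). The bias of a local estimator is
  `-n l R_D (f + S† g)`. For `f` the trivial bound `‖R_D‖ ≤ 1 / (n l)` suffices in the inequality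
  above, for `S† g` the second bound does, and both parts are of order `l ^ (2 r)` in mean square.
* Variance. Distinct noise variables are uncorrelated given the inputs
  (`integrable_and_integral_norm_sum_noise_le`). By Parseval's identity in `L²`, the variance of a
  local estimator is a sum of terms `E ⟪S† e, R_D S† e⟫` over an orthonormal basis. Splitting `e` by
  `(l I + L_K)⁻¹` in the same way bounds each by a multiple of `⟪(l I + L_K)⁻¹ L_K e, e⟫ / n`, and
  these add up to the effective dimension over `n` (`card_mul_integral_sum_norm_sq_le`). Averaging
  replaces `n` by the total sample size `N`.

For `l = C₁ N ^ (-1 / (2 r + s))` the two orders `l ^ (2 r)` and `l ^ (-s) / N` agree. The lower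
bound on the local sample sizes enters only in making `c` a constant.
-/

namespace DKRR

/-! ### Regularized inverses of positive operators -/

section Resolvent

variable {E : Type*} [NormedAddCommGroup E] [InnerProductSpace ℝ E] [CompleteSpace E]

/-- The regularized inverse `(τ I + A)⁻¹`, spelled as in `effectiveDimension`. It is a genuine
inverse when `A` is positive and `τ > 0`. -/
noncomputable def regInv (A : E →L[ℝ] E) (τ : ℝ) : E →L[ℝ] E :=
  Ring.inverse (τ • ContinuousLinearMap.id ℝ E + A)

variable {A : E →L[ℝ] E} {τ : ℝ}

theorem isUnit_smul_id_add (hA : A.IsPositive) (hτ : 0 < τ) :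
    IsUnit (τ • ContinuousLinearMap.id ℝ E + A) := by
  refine ContinuousLinearMap.isUnit_of_forall_le_norm_inner_map _ (c := ⟨τ, hτ.le⟩) hτ fun x => ?_
  have h := hA.inner_nonneg_left x
  have h2 : ⟪(τ • ContinuousLinearMap.id ℝ E + A) x, x⟫ = τ * ‖x‖ ^ 2 + ⟪A x, x⟫ := by
    simp [inner_add_left, inner_smul_left]
  rw [h2]
  refine le_trans ?_ (Real.le_norm_self _)
  change ‖x‖ ^ 2 * τ ≤ _
  linarith

theorem regInv_spec (hA : A.IsPositive) (hτ : 0 < τ) (f : E) :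
    τ • regInv A τ f + A (regInv A τ f) = f := by
  have h := Ring.mul_inverse_cancel _ (isUnit_smul_id_add hA hτ)
  have := congrArg (fun T : E →L[ℝ] E => T f) h
  simpa [regInv] using this

theorem regInv_spec' (hA : A.IsPositive) (hτ : 0 < τ) (f : E) :
    regInv A τ (τ • f + A f) = f := by
  have h := Ring.inverse_mul_cancel _ (isUnit_smul_id_add hA hτ)
  have := congrArg (fun T : E →L[ℝ] E => T f) h
  simpa [regInv] using this

theorem regInv_eq_iff (hA : A.IsPositive) (hτ : 0 < τ) {f g : E} :
    regInv A τ f = g ↔ τ • g + A g = f :=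
  ⟨fun h => h ▸ regInv_spec hA hτ f, fun h => h ▸ regInv_spec' hA hτ g⟩

theorem apply_regInv_comm (hA : A.IsPositive) (hτ : 0 < τ) (f : E) :
    A (regInv A τ f) = regInv A τ (A f) := by
  rw [eq_comm, regInv_eq_iff hA hτ, ← map_smul, ← map_add, regInv_spec hA hτ]

theorem inner_regInv_comm (hA : A.IsPositive) (hτ : 0 < τ) (f g : E) :
    ⟪regInv A τ f, g⟫ = ⟪f, regInv A τ g⟫ := by
  conv_lhs => rw [← regInv_spec hA hτ g]
  conv_rhs => rw [← regInv_spec hA hτ f]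
  simp only [inner_add_left, inner_add_right, inner_smul_left, inner_smul_right,
    hA.inner_left_eq_inner_right, RCLike.conj_to_real]

theorem inner_regInv_self (hA : A.IsPositive) (hτ : 0 < τ) (f : E) :
    ⟪f, regInv A τ f⟫ = τ * ‖regInv A τ f‖ ^ 2 + ⟪A (regInv A τ f), regInv A τ f⟫ := by
  have h : ⟪τ • regInv A τ f + A (regInv A τ f), regInv A τ f⟫ = ⟪f, regInv A τ f⟫ := by
    rw [regInv_spec hA hτ]
  rw [← h, inner_add_left, inner_smul_left, real_inner_self_eq_norm_sq]
  simp

theorem inner_regInv_nonneg (hA : A.IsPositive) (hτ : 0 < τ) (f : E) :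
    0 ≤ ⟪f, regInv A τ f⟫ := by
  rw [inner_regInv_self hA hτ]
  have := hA.inner_nonneg_left (regInv A τ f)
  positivity

theorem norm_regInv_le (hA : A.IsPositive) (hτ : 0 < τ) (f : E) :
    ‖regInv A τ f‖ ≤ ‖f‖ / τ := by
  rw [le_div_iff₀ hτ]
  have h1 := inner_regInv_self hA hτ f
  have h2 := hA.inner_nonneg_left (regInv A τ f)
  have h3 := real_inner_le_norm f (regInv A τ f)
  rcases (norm_nonneg (regInv A τ f)).eq_or_lt with h | h
  · rw [← h, zero_mul]; exact norm_nonneg f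
  · refine le_of_mul_le_mul_right ?_ h
    nlinarith

theorem inner_regInv_le (hA : A.IsPositive) (hτ : 0 < τ) (f : E) :
    ⟪f, regInv A τ f⟫ ≤ ‖f‖ ^ 2 / τ := by
  calc ⟪f, regInv A τ f⟫ ≤ ‖f‖ * ‖regInv A τ f‖ := real_inner_le_norm _ _
    _ ≤ ‖f‖ * (‖f‖ / τ) := mul_le_mul_of_nonneg_left (norm_regInv_le hA hτ f) (norm_nonneg f)
    _ = ‖f‖ ^ 2 / τ := by ring

/-- Convexity of the quadratic form `u ↦ ⟪u, (τ I + A)⁻¹ u⟫`, for splitting a vector in two. -/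
theorem inner_regInv_add_le (hA : A.IsPositive) (hτ : 0 < τ) (f g : E) :
    ⟪f + g, regInv A τ (f + g)⟫ ≤ 2 * ⟪f, regInv A τ f⟫ + 2 * ⟪g, regInv A τ g⟫ := by
  have h := inner_regInv_nonneg hA hτ (f - g)
  have hs := inner_regInv_comm hA hτ f g
  rw [real_inner_comm] at hs
  simp only [map_add, map_sub, inner_add_left, inner_add_right, inner_sub_left,
    inner_sub_right] at h ⊢
  linarith

theorem continuous_regInv {T : Type*} [TopologicalSpace T] {B : T → E →L[ℝ] E}
    (hB : Continuous B) (hpos : ∀ t, (B t).IsPositive) (hτ : 0 < τ) :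
    Continuous fun t => regInv (B t) τ := by
  rw [continuous_iff_continuousAt]
  intro t
  obtain ⟨u, hu⟩ := isUnit_smul_id_add (hpos t) hτ
  have h := NormedRing.inverse_continuousAt u
  rw [hu] at h
  exact h.comp (f := fun t => τ • ContinuousLinearMap.id ℝ E + B t)
    (continuous_const.add hB).continuousAt

/-- The rank-one update formula (Sherman-Morrison), in implicit form. -/
theorem regInv_add_rankOne (hA : A.IsPositive) (hτ : 0 < τ) (v f : E) :
    regInv (A + InnerProductSpace.rankOne ℝ v v) τ f = regInv A τ f -
      ⟪v, regInv (A + InnerProductSpace.rankOne ℝ v v) τ f⟫ • regInv A τ v := by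
  have hA' := hA.add (InnerProductSpace.isPositive_rankOne_self (𝕜 := ℝ) v)
  have h := regInv_spec hA' hτ f
  set g := regInv (A + InnerProductSpace.rankOne ℝ v v) τ f
  rw [← map_smul, ← map_sub, eq_comm, regInv_eq_iff hA hτ, eq_sub_iff_add_eq, ← h]
  simp [add_assoc]

theorem inner_regInv_eq_mul_inner_regInv_add (hA : A.IsPositive) (hτ : 0 < τ) (v f : E) :
    ⟪v, regInv A τ f⟫ = (1 + ⟪v, regInv A τ v⟫) *
      ⟪v, regInv (A + InnerProductSpace.rankOne ℝ v v) τ f⟫ := by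
  have h := congrArg (fun u => ⟪v, u⟫) (regInv_add_rankOne hA hτ v f)
  simp only [inner_sub_right, inner_smul_right] at h
  linarith

/-- Adding a rank-one positive operator decreases the regularized inverse. -/
theorem inner_regInv_add_rankOne_le (hA : A.IsPositive) (hτ : 0 < τ) (v f : E) :
    ⟪f, regInv (A + InnerProductSpace.rankOne ℝ v v) τ f⟫ ≤ ⟪f, regInv A τ f⟫ := by
  have hv := inner_regInv_nonneg hA hτ v
  have hk := inner_regInv_eq_mul_inner_regInv_add hA hτ v f
  have h := congrArg (fun u => ⟪f, u⟫) (regInv_add_rankOne hA hτ v f)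
  have hs : ⟪f, regInv A τ v⟫ = ⟪v, regInv A τ f⟫ := by
    rw [← inner_regInv_comm hA hτ, real_inner_comm]
  simp only [inner_sub_right, inner_smul_right, hs, hk] at h
  rw [h]
  have := mul_nonneg (add_nonneg zero_le_one hv)
    (sq_nonneg ⟪v, regInv (A + InnerProductSpace.rankOne ℝ v v) τ f⟫)
  linarith

/-- The splitting `f = τ R f + A R f`, `R = (τ I + A)⁻¹`, measured in the two norms that control
the two error terms; for `h` this is an exact decomposition of `⟪R A h, h⟫`. -/
theorem inner_regInv_apply_self (hA : A.IsPositive) (hτ : 0 < τ) (h : E) :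
    ⟪regInv A τ (A h), h⟫ =
      τ * ⟪A (regInv A τ h), regInv A τ h⟫ + ‖A (regInv A τ h)‖ ^ 2 := by
  have h1 : ⟪A (regInv A τ h), τ • regInv A τ h + A (regInv A τ h)⟫ = ⟪A (regInv A τ h), h⟫ := by
    rw [regInv_spec hA hτ]
  rw [← apply_regInv_comm hA hτ, ← h1, inner_add_right, inner_smul_right,
    real_inner_self_eq_norm_sq]

end Resolvent

/-! ### Empirical covariance operators -/

section Covariance

variable {E : Type*} [NormedAddCommGroup E] [InnerProductSpace ℝ E] {ι : Type*} [Fintype ι]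

/-- The unnormalized empirical covariance operator `∑ i, v i ⊗ v i` of a family of vectors. -/
noncomputable def covOp (v : ι → E) : E →L[ℝ] E :=
  ∑ i, InnerProductSpace.rankOne ℝ (v i) (v i)

theorem covOp_apply (v : ι → E) (f : E) : covOp v f = ∑ i, ⟪v i, f⟫ • v i := by
  simp [covOp]

theorem isPositive_covOp (v : ι → E) : (covOp v).IsPositive := by
  unfold covOp
  refine Finset.sum_induction _ (fun T : E →L[ℝ] E => T.IsPositive)
    (fun _ _ => ContinuousLinearMap.IsPositive.add) ContinuousLinearMap.isPositive_zero
    fun i _ => InnerProductSpace.isPositive_rankOne_self _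

theorem inner_covOp_self (v : ι → E) (f : E) : ⟪covOp v f, f⟫ = ∑ i, ⟪v i, f⟫ ^ 2 := by
  simp [covOp_apply, sum_inner, inner_smul_left, sq]

theorem continuous_covOp : Continuous (covOp : (ι → E) → E →L[ℝ] E) := by
  unfold covOp
  refine continuous_finsetSum _ fun i _ => ?_
  simp only [InnerProductSpace.rankOne_def]
  fun_prop

variable [CompleteSpace E]

theorem sum_inner_regInv_covOp_sq_le (v : ι → E) {τ : ℝ} (hτ : 0 < τ) (f : E) :
    ∑ i, ⟪v i, regInv (covOp v) τ f⟫ ^ 2 ≤ ⟪f, regInv (covOp v) τ f⟫ := by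
  rw [inner_regInv_self (isPositive_covOp v) hτ, inner_covOp_self]
  exact le_add_of_nonneg_left (by positivity)

theorem sum_inner_regInv_covOp_add_sq_le (v : ι → E) (w : E) {τ : ℝ} (hτ : 0 < τ) (f : E) :
    ∑ i, ⟪v i, regInv (covOp v + InnerProductSpace.rankOne ℝ w w) τ f⟫ ^ 2 ≤
      ⟪f, regInv (covOp v + InnerProductSpace.rankOne ℝ w w) τ f⟫ := by
  have hpos := (isPositive_covOp v).add (InnerProductSpace.isPositive_rankOne_self (𝕜 := ℝ) w)
  rw [inner_regInv_self hpos hτ, add_apply, inner_add_left, inner_covOp_self]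
  have := (InnerProductSpace.isPositive_rankOne_self (𝕜 := ℝ) w).inner_nonneg_left
    (regInv (covOp v + InnerProductSpace.rankOne ℝ w w) τ f)
  have h2 : 0 ≤ τ * ‖regInv (covOp v + InnerProductSpace.rankOne ℝ w w) τ f‖ ^ 2 := by positivity
  linarith

end Covariance

/-! ### Reindexing and resampling independent samples -/

section Sampling

variable {Z : Type*} [MeasurableSpace Z] (ρ : Measure Z) [IsProbabilityMeasure ρ]
  {ι κ : Type*} [Fintype ι] [Fintype κ]

theorem measurePreserving_comp_of_injective {e : κ → ι} (he : Function.Injective e) :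
    MeasurePreserving (fun (D : ι → Z) k => D (e k)) (Measure.pi fun _ => ρ)
      (Measure.pi fun _ => ρ) := by
  have hm : Measurable fun (D : ι → Z) k => D (e k) := by fun_prop
  refine ⟨hm, (Measure.pi_eq fun s hs => ?_).symm⟩
  have hpre : (fun (D : ι → Z) k => D (e k)) ⁻¹' Set.univ.pi s =
      Set.univ.pi (Function.extend e s fun _ => Set.univ) := by
    ext D
    simp only [Set.mem_preimage, Set.mem_univ_pi]
    refine ⟨fun h i => ?_, fun h k => ?_⟩
    · by_cases hi : ∃ k, e k = i
      · obtain ⟨k, rfl⟩ := hi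
        rw [he.extend_apply]; exact h k
      · rw [Function.extend_apply' _ _ _ hi]; trivial
    · have := h (e k)
      rwa [he.extend_apply] at this
  rw [Measure.map_apply hm (.univ_pi hs), hpre, Measure.pi_pi]
  refine (Fintype.prod_of_injective e he _ _ (fun i hi => ?_) fun k => ?_).symm
  · rw [Function.extend_apply' _ _ _ hi, measure_univ]
  · rw [he.extend_apply]

/-- Exchanging the `i`-th sample point with an independent test point preserves the joint law. -/
theorem measurePreserving_update_swap [DecidableEq ι] (i : ι) :
    MeasurePreserving (fun p : (ι → Z) × Z => (Function.update p.1 i p.2, p.1 i))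
      ((Measure.pi fun _ => ρ).prod ρ) ((Measure.pi fun _ => ρ).prod ρ) := by
  have hE : MeasurePreserving (fun q : Option ι → Z => ((fun k => q (some k)), q none))
      (Measure.pi fun _ => ρ) ((Measure.pi fun _ : ι => ρ).prod ρ) := by
    have h : MeasurePreserving (MeasurableEquiv.piOptionEquivProd fun _ : Option ι => Z).symm
        ((Measure.pi fun _ : ι => ρ).prod ρ) (Measure.pi fun _ => ρ) :=
      ⟨MeasurableEquiv.measurable _, Measure.pi_map_piOptionEquivProd fun _ => ρ⟩
    exact h.symm _
  have hσ : MeasurePreserving (fun (q : Option ι → Z) k => q (Equiv.swap none (some i) k))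
      (Measure.pi fun _ => ρ) (Measure.pi fun _ => ρ) :=
    measurePreserving_comp_of_injective ρ (Equiv.swap none (some i)).injective
  have hm : Measurable fun p : (ι → Z) × Z => (Function.update p.1 i p.2, p.1 i) := by
    refine Measurable.prodMk (measurable_pi_iff.2 fun k => ?_) (by fun_prop)
    by_cases hk : k = i
    · subst hk; simpa using measurable_snd
    · simp only [Function.update_of_ne hk]; fun_prop
  refine ⟨hm, ?_⟩
  conv_lhs => rw [← hE.map_eq]
  rw [Measure.map_map hm hE.measurable, ← (hE.comp hσ).map_eq]
  congr 1
  funext q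
  refine Prod.ext (funext fun k => ?_) ?_
  · by_cases hk : k = i
    · subst hk; simp
    · simp [hk, Equiv.swap_apply_of_ne_of_ne]
  · simp

/-- Resampling one coordinate preserves the law of the sample. -/
theorem measurePreserving_update [DecidableEq ι] (i : ι) :
    MeasurePreserving (fun p : (ι → Z) × Z => Function.update p.1 i p.2)
      ((Measure.pi fun _ => ρ).prod ρ) (Measure.pi fun _ => ρ) :=
  measurePreserving_fst.comp (measurePreserving_update_swap ρ i)

end Sampling

/-! ### Leave-one-out bounds for the regularized empirical covariance -/

theorem inner_sq_le_of_norm_le {E Z : Type*} [NormedAddCommGroup E] [InnerProductSpace ℝ E]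
    {φ : Z → E} {κ : ℝ} {z : Z} (hκ : ∀ z, ‖φ z‖ ≤ κ) {g : E} {b : ℝ} (hg : ‖g‖ ≤ b) :
    ‖⟪φ z, g⟫ ^ 2‖ ≤ (κ * b) ^ 2 := by
  rw [norm_pow]
  refine pow_le_pow_left₀ (norm_nonneg _) ((norm_inner_le_norm _ _).trans ?_) 2
  exact mul_le_mul (hκ z) hg (norm_nonneg _) ((norm_nonneg _).trans (hκ z))

section LeaveOneOut

variable {E : Type*} [NormedAddCommGroup E] [InnerProductSpace ℝ E] [CompleteSpace E]
  {Z : Type*} {ι : Type*} [Fintype ι] {φ : Z → E} {κ τ : ℝ}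

/-- The regularized inverse `(τ I + ∑ i, φ(D i) ⊗ φ(D i))⁻¹` attached to a sample `D`. -/
noncomputable def sampleInv (φ : Z → E) (τ : ℝ) (D : ι → Z) : E →L[ℝ] E :=
  regInv (covOp fun i => φ (D i)) τ

theorem continuous_sampleInv [TopologicalSpace Z] (hφ : Continuous φ) (hτ : 0 < τ) :
    Continuous (sampleInv φ τ : (ι → Z) → E →L[ℝ] E) :=
  continuous_regInv (continuous_covOp.comp (by fun_prop)) (fun _ => isPositive_covOp _) hτ

variable [TopologicalSpace Z] [SecondCountableTopology Z] [MeasurableSpace Z]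
  [OpensMeasurableSpace Z] (ρ : Measure Z) [IsProbabilityMeasure ρ]

theorem integrable_inner_sampleInv (hφ : Continuous φ) (hτ : 0 < τ) (f : E) :
    Integrable (fun D : ι → Z => ⟪f, sampleInv φ τ D f⟫) (Measure.pi fun _ => ρ) := by
  have hc := continuous_sampleInv (ι := ι) hφ hτ
  refine Integrable.of_bound (C := ‖f‖ ^ 2 / τ)
    (Continuous.aestronglyMeasurable (by fun_prop)) (.of_forall fun D => ?_)
  refine (Real.norm_of_nonneg (inner_regInv_nonneg (isPositive_covOp _) hτ f)).trans_le ?_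
  exact inner_regInv_le (isPositive_covOp _) hτ f

theorem integrable_inner_sampleInv_sq (hφ : Continuous φ) (hκ : ∀ z, ‖φ z‖ ≤ κ) (hτ : 0 < τ)
    (f : E) : Integrable (fun p : (ι → Z) × Z => ⟪φ p.2, sampleInv φ τ p.1 f⟫ ^ 2)
      ((Measure.pi fun _ => ρ).prod ρ) := by
  have hc := continuous_sampleInv (ι := ι) hφ hτ
  exact Integrable.of_bound (C := (κ * (‖f‖ / τ)) ^ 2)
    (Continuous.aestronglyMeasurable (by fun_prop)) (.of_forall fun p =>
      inner_sq_le_of_norm_le hκ (norm_regInv_le (isPositive_covOp _) hτ f))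

/-- The mean squared prediction of `R_D f` at an independent point is controlled by the quadratic
form of `R_D`: the rank-one update formula turns the test point into an additional sample point,
which is exchangeable with the others, and the sum over all sample points is a quadratic form. -/
theorem card_mul_integral_sampleInv_sq_le (hφ : Continuous φ) (hκ : ∀ z, ‖φ z‖ ≤ κ) (hτ : 0 < τ)
    (f : E) :
    Fintype.card ι * ∫ D : ι → Z, ∫ z, ⟪φ z, sampleInv φ τ D f⟫ ^ 2 ∂ρ ∂(Measure.pi fun _ => ρ) ≤
      (1 + κ ^ 2 / τ) ^ 2 * ∫ D : ι → Z, ⟪f, sampleInv φ τ D f⟫ ∂(Measure.pi fun _ => ρ) := by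
  classical
  set P : Measure ((ι → Z) × Z) := (Measure.pi fun _ => ρ).prod ρ with hP
  set B : (ι → Z) × Z → E →L[ℝ] E := fun p =>
    covOp (fun i => φ (p.1 i)) + InnerProductSpace.rankOne ℝ (φ p.2) (φ p.2) with hB
  have hpos : ∀ p, (B p).IsPositive := fun p =>
    (isPositive_covOp _).add (InnerProductSpace.isPositive_rankOne_self _)
  have hBc : Continuous B := by
    refine (continuous_covOp.comp (by fun_prop)).add ?_
    simp only [InnerProductSpace.rankOne_def]
    fun_prop
  have hRc : Continuous fun p => regInv (B p) τ := continuous_regInv hBc hpos hτ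
  set c := 1 + κ ^ 2 / τ
  have hswap : ∀ i (p : (ι → Z) × Z), B (Function.update p.1 i p.2, p.1 i) = B p := by
    intro i p
    simp only [hB, covOp]
    rw [← Finset.add_sum_erase _ _ (Finset.mem_univ i),
      ← Finset.add_sum_erase (a := i) Finset.univ
        (fun k => InnerProductSpace.rankOne ℝ (φ (p.1 k)) (φ (p.1 k))) (Finset.mem_univ i)]
    rw [Finset.sum_congr (g := fun k => InnerProductSpace.rankOne ℝ (φ (p.1 k)) (φ (p.1 k))) rfl
      fun k hk => by rw [Function.update_of_ne (Finset.ne_of_mem_erase hk)]]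
    simp only [Function.update_self]
    abel
  have hint : ∀ i, Integrable (fun p : (ι → Z) × Z => ⟪φ (p.1 i), regInv (B p) τ f⟫ ^ 2) P :=
    fun i => Integrable.of_bound (C := (κ * (‖f‖ / τ)) ^ 2)
      (Continuous.aestronglyMeasurable (by fun_prop)) (.of_forall fun p =>
        inner_sq_le_of_norm_le hκ (norm_regInv_le (hpos p) hτ f))
  have hint' : Integrable (fun p : (ι → Z) × Z => ⟪φ p.2, regInv (B p) τ f⟫ ^ 2) P :=
    Integrable.of_bound (C := (κ * (‖f‖ / τ)) ^ 2)
      (Continuous.aestronglyMeasurable (by fun_prop)) (.of_forall fun p =>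
        inner_sq_le_of_norm_le hκ (norm_regInv_le (hpos p) hτ f))
  have hex : ∀ i, ∫ p, ⟪φ (p.1 i), regInv (B p) τ f⟫ ^ 2 ∂P =
      ∫ p, ⟪φ p.2, regInv (B p) τ f⟫ ^ 2 ∂P := by
    intro i
    have hmp := measurePreserving_update_swap ρ (ι := ι) i
    have hme : AEStronglyMeasurable (fun p : (ι → Z) × Z => ⟪φ p.2, regInv (B p) τ f⟫ ^ 2)
        (Measure.map (fun p : (ι → Z) × Z => (Function.update p.1 i p.2, p.1 i)) P) := by
      rw [hmp.map_eq]; exact hint'.aestronglyMeasurable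
    have h := integral_map hmp.measurable.aemeasurable hme
    rw [hmp.map_eq] at h
    rw [h]
    simp only [hswap]
  have h1 : ∫ D : ι → Z, ∫ z, ⟪φ z, sampleInv φ τ D f⟫ ^ 2 ∂ρ ∂(Measure.pi fun _ => ρ) ≤
      c ^ 2 * ∫ p, ⟪φ p.2, regInv (B p) τ f⟫ ^ 2 ∂P := by
    rw [← integral_prod _ (integrable_inner_sampleInv_sq ρ hφ hκ hτ f), ← integral_const_mul]
    refine integral_mono (integrable_inner_sampleInv_sq ρ hφ hκ hτ f) (hint'.const_mul _)
      fun p => ?_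
    have hA := isPositive_covOp fun i => φ (p.1 i)
    have h0 := inner_regInv_nonneg hA hτ (φ p.2)
    have hle : ⟪φ p.2, regInv (covOp fun i => φ (p.1 i)) τ (φ p.2)⟫ ≤ κ ^ 2 / τ :=
      (inner_regInv_le hA hτ _).trans
        (div_le_div_of_nonneg_right (pow_le_pow_left₀ (norm_nonneg _) (hκ _) 2) hτ.le)
    change ⟪φ p.2, regInv (covOp fun i => φ (p.1 i)) τ f⟫ ^ 2 ≤ _
    rw [inner_regInv_eq_mul_inner_regInv_add hA hτ, mul_pow]
    refine mul_le_mul_of_nonneg_right (pow_le_pow_left₀ (by linarith) ?_ 2) (sq_nonneg _)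
    simp only [c]; linarith
  have h2 : Fintype.card ι * ∫ p, ⟪φ p.2, regInv (B p) τ f⟫ ^ 2 ∂P ≤
      ∫ D : ι → Z, ⟪f, sampleInv φ τ D f⟫ ∂(Measure.pi fun _ => ρ) := by
    have h3 : (Fintype.card ι : ℝ) * ∫ p, ⟪φ p.2, regInv (B p) τ f⟫ ^ 2 ∂P =
        ∫ p, ∑ i, ⟪φ (p.1 i), regInv (B p) τ f⟫ ^ 2 ∂P := by
      rw [integral_finsetSum _ fun i _ => hint i]
      simp [hex]
    have h4 : ∫ D : ι → Z, ⟪f, sampleInv φ τ D f⟫ ∂(Measure.pi fun _ => ρ) =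
        ∫ p : (ι → Z) × Z, ⟪f, sampleInv φ τ p.1 f⟫ ∂P := by
      rw [integral_fun_fst (fun D : ι → Z => ⟪f, sampleInv φ τ D f⟫)]
      simp
    rw [h3, h4]
    refine integral_mono (integrable_finsetSum _ fun i _ => hint i)
      ((integrable_inner_sampleInv ρ hφ hτ f).comp_fst ρ) fun p => ?_
    exact (sum_inner_regInv_covOp_add_sq_le _ _ hτ f).trans
      (inner_regInv_add_rankOne_le (isPositive_covOp _) hτ _ f)
  have hc : 0 ≤ c ^ 2 := sq_nonneg c
  calc _ ≤ (Fintype.card ι : ℝ) * (c ^ 2 * ∫ p, ⟪φ p.2, regInv (B p) τ f⟫ ^ 2 ∂P) :=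
        mul_le_mul_of_nonneg_left h1 (Nat.cast_nonneg _)
    _ = c ^ 2 * (Fintype.card ι * ∫ p, ⟪φ p.2, regInv (B p) τ f⟫ ^ 2 ∂P) := by ring
    _ ≤ _ := mul_le_mul_of_nonneg_left h2 hc

theorem integral_sq_le_integral_sq {Ω : Type*} [MeasurableSpace Ω] {P : Measure Ω}
    [IsProbabilityMeasure P] {F : Ω → ℝ} (hF : Integrable F P)
    (hF2 : Integrable (fun ω => F ω ^ 2) P) : (∫ ω, F ω ∂P) ^ 2 ≤ ∫ ω, F ω ^ 2 ∂P := by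
  have h := variance_nonneg F P
  rw [variance_eq_sub ((memLp_two_iff_integrable_sq hF.aestronglyMeasurable).2 hF2)] at h
  simpa using sub_nonneg.1 h

/-- If `f` is dominated by the second moment form of `φ`, as is every element of the range of the
integral operator, then the quadratic form of `R_D` at `f` is of order `1 / n` in the mean,
however small `τ / n` is. The leave-one-out bound estimates the mean `a` of that form by a multiple
of `√a`. -/
theorem card_mul_integral_inner_sampleInv_le (hφ : Continuous φ) (hκ : ∀ z, ‖φ z‖ ≤ κ)
    (hτ : 0 < τ) {f : E} {b : ℝ} (hf : ∀ g, ⟪f, g⟫ ^ 2 ≤ b ^ 2 * ∫ z, ⟪φ z, g⟫ ^ 2 ∂ρ) :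
    Fintype.card ι * ∫ D : ι → Z, ⟪f, sampleInv φ τ D f⟫ ∂(Measure.pi fun _ => ρ) ≤
      (1 + κ ^ 2 / τ) ^ 2 * b ^ 2 := by
  have hK := card_mul_integral_sampleInv_sq_le (ι := ι) ρ hφ hκ hτ f
  have hI := integrable_inner_sampleInv (ι := ι) ρ hφ hτ f
  have hI2 := (integrable_inner_sampleInv_sq (ι := ι) ρ hφ hκ hτ f).integral_prod_left
  have hc := continuous_sampleInv (ι := ι) hφ hτ
  have hIs : Integrable (fun D : ι → Z => ⟪f, sampleInv φ τ D f⟫ ^ 2) (Measure.pi fun _ => ρ) := by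
    refine Integrable.of_bound (C := (‖f‖ * (‖f‖ / τ)) ^ 2)
      (Continuous.aestronglyMeasurable (by fun_prop)) (.of_forall fun D => ?_)
    rw [norm_pow]
    exact pow_le_pow_left₀ (norm_nonneg _) ((norm_inner_le_norm _ _).trans
      (mul_le_mul_of_nonneg_left (norm_regInv_le (isPositive_covOp _) hτ f) (norm_nonneg f))) 2
  have hJ := integral_sq_le_integral_sq hI hIs
  have hle : ∫ D : ι → Z, ⟪f, sampleInv φ τ D f⟫ ^ 2 ∂(Measure.pi fun _ => ρ) ≤
      b ^ 2 * ∫ D : ι → Z, ∫ z, ⟪φ z, sampleInv φ τ D f⟫ ^ 2 ∂ρ ∂(Measure.pi fun _ => ρ) := by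
    rw [← integral_const_mul]
    exact integral_mono hIs (hI2.const_mul _) fun D => hf _
  set a := ∫ D : ι → Z, ⟪f, sampleInv φ τ D f⟫ ∂(Measure.pi fun _ => ρ)
  have ha : 0 ≤ a := integral_nonneg fun D => inner_regInv_nonneg (isPositive_covOp _) hτ f
  rcases ha.eq_or_lt with h0 | h0
  · rw [← h0, mul_zero]; positivity
  · refine le_of_mul_le_mul_right ?_ h0
    have hn : (0 : ℝ) ≤ Fintype.card ι := Nat.cast_nonneg _
    have := mul_le_mul_of_nonneg_left (hJ.trans hle) hn
    have := mul_le_mul_of_nonneg_left hK (sq_nonneg b)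
    nlinarith

end LeaveOneOut

theorem countable_of_orthonormal {E : Type*} [NormedAddCommGroup E] [InnerProductSpace ℝ E]
    [TopologicalSpace.SeparableSpace E] {w : Set E} (hw : Orthonormal ℝ ((↑) : w → E)) :
    w.Countable := by
  have hd : w.PairwiseDisjoint fun e => Metric.ball e (1 / 2) := by
    intro e he f hf hne
    refine Metric.ball_disjoint_ball ?_
    have h0 : ⟪e, f⟫ = 0 := hw.2 (i := ⟨e, he⟩) (j := ⟨f, hf⟩) (by simpa using hne)
    have h1 : ‖e‖ = 1 := hw.1 ⟨e, he⟩
    have h2 : ‖f‖ = 1 := hw.1 ⟨f, hf⟩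
    have h3 := norm_sub_sq_real e f
    rw [h0, h1, h2] at h3
    rw [dist_eq_norm]
    nlinarith [norm_nonneg (e - f)]
  exact hd.countable_of_isOpen (fun _ _ => Metric.isOpen_ball) fun e _ =>
    ⟨e, Metric.mem_ball_self (by norm_num)⟩

theorem norm_sq_eq_integral {α : Type*} [MeasurableSpace α] {μ : Measure α} (f : Lp ℝ 2 μ) :
    ‖f‖ ^ 2 = ∫ a, f a ^ 2 ∂μ := by
  rw [← real_inner_self_eq_norm_sq, L2.inner_def]
  simp [sq]

/-! ### The inclusion of the reproducing kernel Hilbert space in `L²` -/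

section Inclusion

variable {X : Type*} (H : Type*) [NormedAddCommGroup H] [InnerProductSpace ℝ H] [CompleteSpace H]
  [RKHS ℝ H X ℝ]

/-- The kernel section `K_x = K(·, x)`, as an element of `H`. -/
noncomputable def kernelSection (x : X) : H := RKHS.kerFun H x 1

theorem inner_kernelSection (x : X) (f : H) : ⟪kernelSection H x, f⟫ = f x := by
  simp [kernelSection]

theorem kernelSection_apply (t x : X) : kernelSection H t x = reproducingKernel H x t :=
  RKHS.kerFun_apply H t 1 x

theorem inner_kernelSection_kernelSection (x t : X) :
    ⟪kernelSection H x, kernelSection H t⟫ = reproducingKernel H x t := by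
  rw [inner_kernelSection, kernelSection_apply]

theorem reproducingKernel_comm (x t : X) : reproducingKernel H x t = reproducingKernel H t x := by
  rw [← inner_kernelSection_kernelSection, real_inner_comm, inner_kernelSection_kernelSection]

variable {H} [MetricSpace X]
  (hK : Continuous (Function.uncurry (reproducingKernel H)))

include hK

theorem continuous_kernelSection : Continuous (kernelSection H : X → H) := by
  rw [continuous_iff_continuousAt]
  intro t
  rw [ContinuousAt, tendsto_iff_norm_sub_tendsto_zero]
  have hsq : ∀ x, ‖kernelSection H x - kernelSection H t‖ ^ 2 =
      reproducingKernel H x x - 2 * reproducingKernel H x t + reproducingKernel H t t := by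
    intro x
    rw [norm_sub_sq_real, ← real_inner_self_eq_norm_sq, ← real_inner_self_eq_norm_sq]
    simp only [inner_kernelSection_kernelSection]
  have h1 : Continuous fun x : X => reproducingKernel H x x :=
    hK.comp (f := fun x : X => (x, x)) (by fun_prop)
  have h2 : Continuous fun x : X => reproducingKernel H x t :=
    hK.comp (f := fun x : X => (x, t)) (by fun_prop)
  have h3 : Continuous fun x : X => Real.sqrt (reproducingKernel H x x -
      2 * reproducingKernel H x t + reproducingKernel H t t) :=
    ((h1.sub (h2.const_mul 2)).add continuous_const).sqrt
  have h4 := h3.tendsto t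
  rw [show reproducingKernel H t t - 2 * reproducingKernel H t t + reproducingKernel H t t = 0 by
    ring, Real.sqrt_zero] at h4
  refine h4.congr fun x => ?_
  rw [← hsq, Real.sqrt_sq (norm_nonneg _)]

theorem continuous_coe (f : H) : Continuous (f : X → ℝ) := by
  have h := continuous_kernelSection hK
  have : (f : X → ℝ) = fun x => ⟪kernelSection H x, f⟫ :=
    funext fun x => (inner_kernelSection H x f).symm
  rw [this]
  fun_prop

theorem continuous_kernelSection_fst : Continuous fun z : X × ℝ => kernelSection H z.1 :=
  (continuous_kernelSection hK).comp continuous_fst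

variable [CompactSpace X]

theorem exists_norm_kernelSection_le : ∃ κ : ℝ, 0 ≤ κ ∧ ∀ x, ‖kernelSection H x‖ ≤ κ := by
  obtain ⟨C, hC⟩ := isCompact_univ.exists_bound_of_continuousOn
    (continuous_kernelSection hK).continuousOn
  exact ⟨max C 0, le_max_right _ _, fun x => (hC x trivial).trans (le_max_left _ _)⟩

variable [MeasurableSpace X] [BorelSpace X] (μ : Measure X) [IsFiniteMeasure μ]

theorem memLp_coe (f : H) : MemLp (f : X → ℝ) 2 μ := by
  obtain ⟨C, hC⟩ := isCompact_univ.exists_bound_of_continuousOn (continuous_coe hK f).continuousOn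
  exact MemLp.of_bound (continuous_coe hK f).aestronglyMeasurable C
    (.of_forall fun x => hC x trivial)

/-- The inclusion `S` of the reproducing kernel Hilbert space in `L²(μ)`. -/
noncomputable def inclusionL2 : H →L[ℝ] Lp ℝ 2 μ :=
  LinearMap.mkContinuousOfExistsBound
    { toFun := fun f => (memLp_coe hK μ f).toLp f
      map_add' := fun f g => by
        rw [← MemLp.toLp_add]
        exact (MemLp.toLp_eq_toLp_iff _ _).2 (.of_forall fun x => by simp)
      map_smul' := fun c f => by
        rw [RingHom.id_apply, ← MemLp.toLp_const_smul]
        exact (MemLp.toLp_eq_toLp_iff _ _).2 (.of_forall fun x => by simp) }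
    (by
      obtain ⟨κ, hκ0, hκ⟩ := exists_norm_kernelSection_le hK
      refine ⟨measureUnivNNReal μ ^ (2 : ℝ≥0∞).toReal⁻¹ * κ, fun f => ?_⟩
      have h := Lp.norm_le_of_ae_bound (p := 2) (f := (memLp_coe hK μ f).toLp f)
        (C := κ * ‖f‖) (by positivity) (by
          filter_upwards [(memLp_coe hK μ f).coeFn_toLp] with x hx
          rw [hx, ← inner_kernelSection]
          exact (norm_inner_le_norm _ _).trans
            (mul_le_mul_of_nonneg_right (hκ x) (norm_nonneg f)))
      refine h.trans (le_of_eq ?_)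
      rw [← mul_assoc])

theorem inclusionL2_ae_eq (f : H) : inclusionL2 hK μ f =ᵐ[μ] f :=
  (memLp_coe hK μ f).coeFn_toLp

theorem norm_inclusionL2_sq (f : H) : ‖inclusionL2 hK μ f‖ ^ 2 = ∫ x, f x ^ 2 ∂μ := by
  rw [norm_sq_eq_integral]
  refine integral_congr_ae ?_
  filter_upwards [inclusionL2_ae_eq hK μ f] with x hx
  rw [hx]

/-- The integral operator factors through the reproducing kernel Hilbert space: `L_K = S S†`. -/
theorem integralOperator_eq_comp_adjoint :
    integralOperator μ hK = inclusionL2 hK μ ∘L (inclusionL2 hK μ).adjoint := by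
  ext1 h
  refine Lp.ext ?_
  filter_upwards [integralOperator_ae_eq μ hK h,
    inclusionL2_ae_eq hK μ ((inclusionL2 hK μ).adjoint h)] with x h1 h2
  rw [h1, ContinuousLinearMap.comp_apply, h2, ← inner_kernelSection,
    ContinuousLinearMap.adjoint_inner_right, L2.inner_def]
  refine integral_congr_ae ?_
  filter_upwards [inclusionL2_ae_eq hK μ (kernelSection H x)] with t ht
  rw [ht, kernelSection_apply, reproducingKernel_comm]
  simp [mul_comm]

theorem integralOperator_apply (h : Lp ℝ 2 μ) :
    integralOperator μ hK h = inclusionL2 hK μ ((inclusionL2 hK μ).adjoint h) := by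
  rw [integralOperator_eq_comp_adjoint]; rfl

theorem isPositive_integralOperator : (integralOperator μ hK).IsPositive := by
  rw [integralOperator_eq_comp_adjoint]
  exact ContinuousLinearMap.isPositive_self_comp_adjoint _

theorem inner_integralOperator (h g : Lp ℝ 2 μ) :
    ⟪integralOperator μ hK h, g⟫ =
      ⟪(inclusionL2 hK μ).adjoint h, (inclusionL2 hK μ).adjoint g⟫ := by
  rw [integralOperator_apply, ContinuousLinearMap.adjoint_inner_right]

theorem norm_adjoint_inclusionL2_sq (h : Lp ℝ 2 μ) :
    ‖(inclusionL2 hK μ).adjoint h‖ ^ 2 = ⟪integralOperator μ hK h, h⟫ := by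
  rw [inner_integralOperator, real_inner_self_eq_norm_sq]

end Inclusion

/-! ### Expected quadratic forms of the empirical regularized inverse -/

section Expectation

variable {X : Type*} [MetricSpace X] [CompactSpace X] [MeasurableSpace X] [BorelSpace X]
  {H : Type*} [NormedAddCommGroup H] [InnerProductSpace ℝ H] [CompleteSpace H] [RKHS ℝ H X ℝ]
  (hK : Continuous (Function.uncurry (reproducingKernel H)))
  (ρ : Measure (X × ℝ)) [IsProbabilityMeasure ρ]
  {ι : Type*} [Fintype ι] {κ l : ℝ}

include hK

theorem integral_inner_kernelSection_sq (g : H) :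
    ∫ z, ⟪kernelSection H z.1, g⟫ ^ 2 ∂ρ = ‖inclusionL2 hK ρ.fst g‖ ^ 2 := by
  rw [norm_inclusionL2_sq, Measure.fst, integral_map (f := fun x => g x ^ 2)
    measurable_fst.aemeasurable ((continuous_coe hK g).pow 2).aestronglyMeasurable]
  simp only [inner_kernelSection]

theorem card_mul_integral_adjoint_le (hκ : ∀ x : X, ‖kernelSection H x‖ ≤ κ) {τ : ℝ} (hτ : 0 < τ)
    (h : Lp ℝ 2 ρ.fst) :
    Fintype.card ι * ∫ D : ι → X × ℝ, ⟪(inclusionL2 hK ρ.fst).adjoint h,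
        sampleInv (fun z : X × ℝ => kernelSection H z.1) τ D ((inclusionL2 hK ρ.fst).adjoint h)⟫
          ∂(Measure.pi fun _ => ρ) ≤
      (1 + κ ^ 2 / τ) ^ 2 * ‖h‖ ^ 2 := by
  refine card_mul_integral_inner_sampleInv_le ρ (continuous_kernelSection_fst hK)
    (fun z => hκ z.1) hτ fun g => ?_
  rw [integral_inner_kernelSection_sq hK, ContinuousLinearMap.adjoint_inner_left, ← mul_pow,
    ← sq_abs]
  exact pow_le_pow_left₀ (abs_nonneg _) (abs_real_inner_le_norm _ _) 2

/-- The bound is the previous one on the part `L (l I + L)⁻¹ h` of `h` and the trivial bound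
`‖R_D‖ ≤ 1 / (n l)` on the part `l (l I + L)⁻¹ h`. -/
theorem card_mul_integral_adjoint_le_inner [Nonempty ι]
    (hκ : ∀ x : X, ‖kernelSection H x‖ ≤ κ) (hl : 0 < l) (h : Lp ℝ 2 ρ.fst) :
    Fintype.card ι * ∫ D : ι → X × ℝ, ⟪(inclusionL2 hK ρ.fst).adjoint h,
        sampleInv (fun z : X × ℝ => kernelSection H z.1) (Fintype.card ι * l) D
          ((inclusionL2 hK ρ.fst).adjoint h)⟫ ∂(Measure.pi fun _ => ρ) ≤
      2 * (1 + κ ^ 2 / (Fintype.card ι * l)) ^ 2 *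
        ⟪regInv (integralOperator ρ.fst hK) l (integralOperator ρ.fst hK h), h⟫ := by
  set n : ℝ := (Fintype.card ι : ℝ)
  have hn : 0 < n := by simp [n, Fintype.card_pos]
  have hτ : 0 < n * l := mul_pos hn hl
  set S := inclusionL2 hK ρ.fst
  set L := integralOperator ρ.fst hK
  have hL : L.IsPositive := isPositive_integralOperator hK ρ.fst
  set c := 1 + κ ^ 2 / (n * l) with hc
  have hc1 : 1 ≤ c ^ 2 := by
    have : 0 ≤ κ ^ 2 / (n * l) := by positivity
    exact one_le_pow₀ (by rw [hc]; linarith)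
  set f₁ := l • S.adjoint (regInv L l h) with hf₁
  set f₂ := S.adjoint (L (regInv L l h)) with hf₂
  have hf : S.adjoint h = f₁ + f₂ := by
    rw [hf₁, hf₂, ← map_smul, ← map_add, regInv_spec hL hl]
  have hφ := continuous_kernelSection_fst hK
  have hI := fun f : H => integrable_inner_sampleInv (ι := ι) ρ hφ hτ f
  have h2 := card_mul_integral_adjoint_le (ι := ι) hK ρ hκ hτ (L (regInv L l h))
  have h1 : n * ∫ D : ι → X × ℝ, ⟪f₁, sampleInv (fun z : X × ℝ => kernelSection H z.1) (n * l) D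
      f₁⟫ ∂(Measure.pi fun _ => ρ) ≤ l * ⟪L (regInv L l h), regInv L l h⟫ := by
    have : ∫ D : ι → X × ℝ, ⟪f₁, sampleInv (fun z : X × ℝ => kernelSection H z.1) (n * l) D
        f₁⟫ ∂(Measure.pi fun _ => ρ) ≤ ‖f₁‖ ^ 2 / (n * l) := by
      refine (integral_mono (hI f₁) (integrable_const (‖f₁‖ ^ 2 / (n * l))) fun D =>
        inner_regInv_le (isPositive_covOp _) hτ f₁).trans (le_of_eq ?_)
      simp
    refine (mul_le_mul_of_nonneg_left this hn.le).trans (le_of_eq ?_)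
    rw [hf₁, norm_smul, mul_pow, norm_adjoint_inclusionL2_sq, Real.norm_eq_abs, sq_abs]
    change n * (l ^ 2 * ⟪L (regInv L l h), regInv L l h⟫ / (n * l)) = _
    field_simp
  have hsplit : ∫ D : ι → X × ℝ, ⟪S.adjoint h, sampleInv (fun z : X × ℝ => kernelSection H z.1)
      (n * l) D (S.adjoint h)⟫ ∂(Measure.pi fun _ => ρ) ≤
      2 * ∫ D : ι → X × ℝ, ⟪f₁, sampleInv (fun z : X × ℝ => kernelSection H z.1) (n * l) D
        f₁⟫ ∂(Measure.pi fun _ => ρ) +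
      2 * ∫ D : ι → X × ℝ, ⟪f₂, sampleInv (fun z : X × ℝ => kernelSection H z.1) (n * l) D
        f₂⟫ ∂(Measure.pi fun _ => ρ) := by
    rw [← integral_const_mul, ← integral_const_mul,
      ← integral_add ((hI f₁).const_mul 2) ((hI f₂).const_mul 2)]
    refine integral_mono (hI _) (((hI f₁).const_mul 2).add ((hI f₂).const_mul 2)) fun D => ?_
    simp only [hf]
    exact inner_regInv_add_le (isPositive_covOp _) hτ f₁ f₂
  have hp : 0 ≤ l * ⟪L (regInv L l h), regInv L l h⟫ :=
    mul_nonneg hl.le (hL.inner_nonneg_left _)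
  rw [inner_regInv_apply_self hL hl]
  have := mul_le_mul_of_nonneg_left hsplit hn.le
  have := mul_le_mul_of_nonneg_right hc1 hp
  linarith

/-- The expected variance term. By Parseval's identity in `L²` it is a sum over an orthonormal
basis of expected quadratic forms, and these add up to the effective dimension. -/
theorem card_mul_integral_sum_norm_sq_le [Nonempty ι]
    (hκ : ∀ x : X, ‖kernelSection H x‖ ≤ κ) (hl : 0 < l) {T : ℝ} (hT : 0 ≤ T)
    (heff : effectiveDimension (integralOperator ρ.fst hK) l ≤ ENNReal.ofReal T) :
    Fintype.card ι * ∫ D : ι → X × ℝ, ∑ i, ‖inclusionL2 hK ρ.fst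
        (sampleInv (fun z : X × ℝ => kernelSection H z.1) (Fintype.card ι * l) D
          (kernelSection H (D i).1))‖ ^ 2 ∂(Measure.pi fun _ => ρ) ≤
      2 * (1 + κ ^ 2 / (Fintype.card ι * l)) ^ 2 * T := by
  set n : ℝ := (Fintype.card ι : ℝ)
  have hn : 0 < n := by simp [n, Fintype.card_pos]
  have hτ : 0 < n * l := mul_pos hn hl
  set S := inclusionL2 hK ρ.fst
  set L := integralOperator ρ.fst hK
  set c := 1 + κ ^ 2 / (n * l)
  set φ := fun z : X × ℝ => kernelSection H z.1
  set P : Measure (ι → X × ℝ) := Measure.pi fun _ => ρ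
  have hφ : Continuous φ := continuous_kernelSection_fst hK
  have hRc : Continuous (sampleInv φ (n * l) : (ι → X × ℝ) → H →L[ℝ] H) :=
    continuous_sampleInv hφ hτ
  obtain ⟨w, b, hb⟩ := exists_hilbertBasis ℝ (Lp ℝ 2 ρ.fst)
  have hbo : Orthonormal ℝ ((↑) : w → Lp ℝ 2 ρ.fst) := hb ▸ b.orthonormal
  have : Fact ((2 : ℝ≥0∞) ≠ ∞) := ⟨ENNReal.ofNat_ne_top⟩
  have hw : Countable w := (countable_of_orthonormal hbo).to_subtype
  have hF : ∀ D : ι → X × ℝ,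
      ENNReal.ofReal (∑ i, ‖S (sampleInv φ (n * l) D (φ (D i)))‖ ^ 2) ≤
        ∑' k : w, ENNReal.ofReal ⟪S.adjoint k, sampleInv φ (n * l) D (S.adjoint k)⟫ := by
    intro D
    have hs : HasSum (fun k : w => ∑ i, ⟪φ (D i), sampleInv φ (n * l) D (S.adjoint k)⟫ ^ 2)
        (∑ i, ‖S (sampleInv φ (n * l) D (φ (D i)))‖ ^ 2) := by
      refine hasSum_sum fun i _ => ?_
      have h := b.hasSum_inner_mul_inner (S (sampleInv φ (n * l) D (φ (D i))))
        (S (sampleInv φ (n * l) D (φ (D i))))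
      rw [real_inner_self_eq_norm_sq] at h
      refine h.congr_fun ?_
      intro k
      have hk : ⟪φ (D i), sampleInv φ (n * l) D (S.adjoint k)⟫ =
          ⟪S (sampleInv φ (n * l) D (φ (D i))), (k : Lp ℝ 2 ρ.fst)⟫ := by
        rw [← ContinuousLinearMap.adjoint_inner_right]
        exact (inner_regInv_comm (isPositive_covOp _) hτ _ _).symm
      rw [hk, hb, real_inner_comm (S _), ← sq]
    rw [← hs.tsum_eq, ENNReal.ofReal_tsum_of_nonneg
      (fun k => Finset.sum_nonneg fun i _ => sq_nonneg _) hs.summable]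
    exact ENNReal.tsum_le_tsum fun k =>
      ENNReal.ofReal_le_ofReal (sum_inner_regInv_covOp_sq_le _ hτ _)
  have hk : ∀ k : w, ∫⁻ D, ENNReal.ofReal ⟪S.adjoint k, sampleInv φ (n * l) D (S.adjoint k)⟫ ∂P ≤
      ENNReal.ofReal (2 * c ^ 2 / n) *
        ENNReal.ofReal ⟪regInv L l (L (k : Lp ℝ 2 ρ.fst)), (k : Lp ℝ 2 ρ.fst)⟫ := by
    intro k
    rw [← ofReal_integral_eq_lintegral_ofReal (integrable_inner_sampleInv ρ hφ hτ _)
      (.of_forall fun D => inner_regInv_nonneg (isPositive_covOp _) hτ _),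
      ← ENNReal.ofReal_mul (by positivity)]
    refine ENNReal.ofReal_le_ofReal ?_
    rw [div_mul_eq_mul_div, le_div_iff₀' hn]
    exact card_mul_integral_adjoint_le_inner hK ρ hκ hl _
  have htr : ∑' k : w, ENNReal.ofReal ⟪regInv L l (L (k : Lp ℝ 2 ρ.fst)), (k : Lp ℝ 2 ρ.fst)⟫ ≤
      ENNReal.ofReal T := by
    refine le_trans ?_ heff
    rw [ENNReal.tsum_eq_iSup_sum]
    refine iSup_le fun F => ?_
    have hFo : Orthonormal ℝ (fun e : F.map (Function.Embedding.subtype (· ∈ w)) =>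
        (e : Lp ℝ 2 ρ.fst)) := by
      refine hbo.comp (fun e : F.map (Function.Embedding.subtype (· ∈ w)) =>
        (⟨e, by obtain ⟨a, -, ha⟩ := Finset.mem_map.1 e.2; exact ha ▸ a.2⟩ : w)) ?_
      intro e e' h
      exact Subtype.ext (Subtype.mk.inj h)
    refine le_trans (le_of_eq ?_) (le_iSup₂ (f := fun (s : Finset (Lp ℝ 2 ρ.fst))
      (_ : Orthonormal ℝ (fun e : s => (e : Lp ℝ 2 ρ.fst))) =>
        ∑ e ∈ s, ENNReal.ofReal ⟪regInv L l (L e), e⟫) _ hFo)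
    rw [Finset.sum_map]
    rfl
  have hint : Integrable (fun D : ι → X × ℝ =>
      ∑ i, ‖S (sampleInv φ (n * l) D (φ (D i)))‖ ^ 2) P := by
    refine integrable_finsetSum _ fun i _ => ?_
    have hc : Continuous fun D : ι → X × ℝ => S (sampleInv φ (n * l) D (φ (D i))) :=
      S.continuous.comp (hRc.clm_apply (hφ.comp (continuous_apply i)))
    refine Integrable.of_bound (C := (‖S‖ * (κ / (n * l))) ^ 2)
      (hc.norm.pow 2).aestronglyMeasurable (.of_forall fun D => ?_)
    rw [Real.norm_of_nonneg (by positivity)]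
    refine pow_le_pow_left₀ (norm_nonneg _) ((S.le_opNorm _).trans ?_) 2
    refine mul_le_mul_of_nonneg_left ((norm_regInv_le (isPositive_covOp _) hτ _).trans ?_)
      (norm_nonneg _)
    exact div_le_div_of_nonneg_right (hκ _) hτ.le
  have hfin : ENNReal.ofReal (∫ D, ∑ i, ‖S (sampleInv φ (n * l) D (φ (D i)))‖ ^ 2 ∂P) ≤
      ENNReal.ofReal (2 * c ^ 2 / n * T) := by
    rw [ofReal_integral_eq_lintegral_ofReal hint
      (.of_forall fun D => Finset.sum_nonneg fun i _ => sq_nonneg _)]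
    calc _ ≤ ∫⁻ D, ∑' k : w, ENNReal.ofReal
            ⟪S.adjoint k, sampleInv φ (n * l) D (S.adjoint k)⟫ ∂P := lintegral_mono hF
      _ = ∑' k : w, ∫⁻ D, ENNReal.ofReal
            ⟪S.adjoint k, sampleInv φ (n * l) D (S.adjoint k)⟫ ∂P :=
          lintegral_tsum fun k => (Continuous.measurable (by fun_prop)).ennreal_ofReal.aemeasurable
      _ ≤ ∑' k : w, ENNReal.ofReal (2 * c ^ 2 / n) * ENNReal.ofReal
            ⟪regInv L l (L (k : Lp ℝ 2 ρ.fst)), (k : Lp ℝ 2 ρ.fst)⟫ := ENNReal.tsum_le_tsum hk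
      _ ≤ ENNReal.ofReal (2 * c ^ 2 / n) * ENNReal.ofReal T := by
          rw [ENNReal.tsum_mul_left]; exact mul_le_mul_right htr _
      _ = ENNReal.ofReal (2 * c ^ 2 / n * T) := (ENNReal.ofReal_mul (by positivity)).symm
  have h := (ENNReal.ofReal_le_ofReal_iff (by positivity)).1 hfin
  rwa [div_mul_eq_mul_div, le_div_iff₀' hn] at h

end Expectation

/-! ### Spectral powers and the source condition -/

section Spectral

variable {E : Type*} [NormedAddCommGroup E] [InnerProductSpace ℝ E] [CompleteSpace E]

theorem summable_and_norm_tsum_sq_le {ι : Type*} {u : ι → E}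
    (hu : Pairwise fun i j => ⟪u i, u j⟫ = 0) {C : ℝ}
    (hC : ∀ s : Finset ι, ∑ i ∈ s, ‖u i‖ ^ 2 ≤ C) : Summable u ∧ ‖∑' i, u i‖ ^ 2 ≤ C := by
  have hV : OrthogonalFamily ℝ (fun i => Submodule.span ℝ {u i})
      fun i => (Submodule.span ℝ {u i}).subtypeₗᵢ := by
    intro i j hij v w
    obtain ⟨a, ha⟩ := Submodule.mem_span_singleton.1 v.2
    obtain ⟨b, hb⟩ := Submodule.mem_span_singleton.1 w.2
    simp [← ha, ← hb, inner_smul_left, inner_smul_right, hu hij]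
  let f : ∀ i, Submodule.span ℝ {u i} := fun i => ⟨u i, Submodule.mem_span_singleton_self _⟩
  have hsum : Summable u := by
    refine (hV.summable_iff_norm_sq_summable f).2 ?_
    exact summable_of_sum_le (fun i => sq_nonneg _) hC
  refine ⟨hsum, le_of_tendsto (hsum.hasSum.norm.pow 2) (.of_forall fun s => ?_)⟩
  have h := hV.norm_sum f s
  exact h.le.trans (hC s)

variable {A : E →L[ℝ] E}

theorem apply_starProjection_ker (μ : ℝ) (h : E) :
    A ((A - μ • ContinuousLinearMap.id ℝ E).ker.starProjection h) =
      μ • (A - μ • ContinuousLinearMap.id ℝ E).ker.starProjection h := by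
  have hm := Submodule.starProjection_apply_mem (A - μ • ContinuousLinearMap.id ℝ E).ker h
  have h0 : (A - μ • ContinuousLinearMap.id ℝ E)
    ((A - μ • ContinuousLinearMap.id ℝ E).ker.starProjection h) = 0 := hm
  simpa [sub_eq_zero] using h0

theorem inner_starProjection_ker_of_ne (hA : A.IsPositive) (h : E) :
    Pairwise fun μ ν : ℝ => ⟪(A - μ • ContinuousLinearMap.id ℝ E).ker.starProjection h,
      (A - ν • ContinuousLinearMap.id ℝ E).ker.starProjection h⟫ = 0 := by
  intro μ ν hne
  have h1 := hA.inner_left_eq_inner_right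
    ((A - μ • ContinuousLinearMap.id ℝ E).ker.starProjection h)
    ((A - ν • ContinuousLinearMap.id ℝ E).ker.starProjection h)
  rw [apply_starProjection_ker, apply_starProjection_ker, real_inner_smul_left,
    real_inner_smul_right] at h1
  have h2 : (μ - ν) * ⟪(A - μ • ContinuousLinearMap.id ℝ E).ker.starProjection h,
      (A - ν • ContinuousLinearMap.id ℝ E).ker.starProjection h⟫ = 0 := by linarith
  exact (mul_eq_zero.1 h2).resolve_left (sub_ne_zero.2 hne)

theorem starProjection_ker_eq_zero_of_neg (hA : A.IsPositive) {μ : ℝ} (hμ : μ < 0) (h : E) :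
    (A - μ • ContinuousLinearMap.id ℝ E).ker.starProjection h = 0 := by
  have h1 := hA.inner_nonneg_left ((A - μ • ContinuousLinearMap.id ℝ E).ker.starProjection h)
  rw [apply_starProjection_ker, real_inner_smul_left, real_inner_self_eq_norm_sq] at h1
  have h2 : ‖(A - μ • ContinuousLinearMap.id ℝ E).ker.starProjection h‖ ^ 2 ≤ 0 := by
    by_contra! h3
    nlinarith
  exact norm_eq_zero.1 (pow_eq_zero_iff two_ne_zero |>.1 (h2.antisymm (sq_nonneg _)))

/-- Bessel's inequality for the eigenspaces of `A`. -/
theorem sum_norm_starProjection_ker_sq_le (hA : A.IsPositive) (h : E) (s : Finset ℝ) :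
    ∑ μ ∈ s, ‖(A - μ • ContinuousLinearMap.id ℝ E).ker.starProjection h‖ ^ 2 ≤ ‖h‖ ^ 2 := by
  set p := fun μ : ℝ => (A - μ • ContinuousLinearMap.id ℝ E).ker.starProjection h
  have h1 : ∀ μ, ⟪h, p μ⟫ = ‖p μ‖ ^ 2 := fun μ => by
    rw [← real_inner_self_eq_norm_sq]
    have := Submodule.starProjection_inner_eq_zero (K := (A - μ • ContinuousLinearMap.id ℝ E).ker)
      h (p μ) (Submodule.starProjection_apply_mem _ h)
    rw [inner_sub_left] at this
    linarith
  have h2 : ⟪∑ μ ∈ s, p μ, ∑ μ ∈ s, p μ⟫ = ∑ μ ∈ s, ‖p μ‖ ^ 2 := by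
    rw [sum_inner]
    refine Finset.sum_congr rfl fun μ hμ => ?_
    rw [inner_sum, Finset.sum_eq_single μ, real_inner_self_eq_norm_sq]
    · exact fun ν _ hne => inner_starProjection_ker_of_ne hA h hne.symm
    · exact fun h => absurd hμ h
  have h3 : 0 ≤ ‖h - ∑ μ ∈ s, p μ‖ ^ 2 := sq_nonneg _
  rw [norm_sub_sq_real, inner_sum, ← real_inner_self_eq_norm_sq (∑ μ ∈ s, p μ), h2] at h3
  simp only [h1] at h3
  change ∑ μ ∈ s, ‖p μ‖ ^ 2 ≤ ‖h‖ ^ 2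
  linarith

theorem rpow_le_rpow_sub_one_mul_add {a μ l : ℝ} (ha : 0 ≤ a) (ha' : a ≤ 1) (hμ : 0 ≤ μ)
    (hl : 0 < l) : μ ^ a ≤ l ^ (a - 1) * (μ + l) := by
  have h := Real.geom_mean_le_arith_mean2_weighted ha (sub_nonneg.2 ha') hμ hl.le (by ring)
  have h2 : μ ^ a * l ^ (1 - a) ≤ μ + l := by nlinarith
  have h3 : l ^ (a - 1) * l ^ (1 - a) = 1 := by
    rw [← Real.rpow_add hl]; simp
  calc μ ^ a = l ^ (a - 1) * (μ ^ a * l ^ (1 - a)) := by linear_combination -μ ^ a * h3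
    _ ≤ _ := mul_le_mul_of_nonneg_left h2 (Real.rpow_nonneg hl.le _)

/-- For `A = S S†` and `1 / 2 ≤ r ≤ 1`, the element `A ^ r h` is `S u` for the sum `u` of
`l (l I + S† S)⁻¹ u`, which is small in norm, and `S† S (l I + S† S)⁻¹ u`, which is `S†` of a vector
of controlled norm. Both parts are constructed as series over the eigenspaces of `A`. -/
theorem exists_spectralPow_eq_split {F : Type*} [NormedAddCommGroup F] [InnerProductSpace ℝ F]
    [CompleteSpace F] (S : F →L[ℝ] E) (hA : A = S ∘L S.adjoint) {r l : ℝ} (hr : 1 / 2 ≤ r)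
    (hr' : r ≤ 1) (hl : 0 < l) (h : E) :
    ∃ (f : F) (g : E), S (f + S.adjoint g) = spectralPow A r h ∧
      ‖f‖ ^ 2 ≤ l ^ (2 * r - 1) * ‖h‖ ^ 2 ∧ ‖g‖ ^ 2 ≤ l ^ (2 * r - 2) * ‖h‖ ^ 2 := by
  have hpos : A.IsPositive := hA ▸ ContinuousLinearMap.isPositive_self_comp_adjoint S
  set p := fun μ : ℝ => (A - μ • ContinuousLinearMap.id ℝ E).ker.starProjection h with hp
  have hAp : ∀ μ, A (p μ) = μ • p μ := fun μ => apply_starProjection_ker μ h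
  have hSS : ∀ v, S (S.adjoint v) = A v := fun v => by rw [hA]; rfl
  have hneg : ∀ μ < 0, p μ = 0 := fun μ hμ => starProjection_ker_eq_zero_of_neg hpos hμ h
  have horth := inner_starProjection_ker_of_ne hpos h
  have hin : ∀ μ ν, ⟪S.adjoint (p μ), S.adjoint (p ν)⟫ = μ * ⟪p μ, p ν⟫ := fun μ ν => by
    rw [ContinuousLinearMap.adjoint_inner_right, hSS, hAp, real_inner_smul_left]
  set u : ℝ → F := fun μ => (l * μ ^ (r - 1) / (μ + l)) • S.adjoint (p μ)
  set v : ℝ → E := fun μ => (μ ^ r / (μ + l)) • p μ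
  have hBes := sum_norm_starProjection_ker_sq_le hpos h
  have hun : ∀ μ, ‖u μ‖ ^ 2 ≤ l ^ (2 * r - 1) * ‖p μ‖ ^ 2 := by
    intro μ
    have hsq : ‖u μ‖ ^ 2 = (l * μ ^ (r - 1) / (μ + l)) ^ 2 * (μ * ‖p μ‖ ^ 2) := by
      rw [norm_smul, mul_pow, ← real_inner_self_eq_norm_sq (S.adjoint _), hin,
        real_inner_self_eq_norm_sq, Real.norm_eq_abs, sq_abs]
    rcases lt_trichotomy μ 0 with hμ | hμ | hμ
    · rw [hsq, hneg μ hμ]; simp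
    · rw [hsq, hμ]; simp; positivity
    · have hy := rpow_le_rpow_sub_one_mul_add (a := r - 1 / 2) (by linarith) (by linarith) hμ.le hl
      have e1 : (μ ^ (r - 1)) ^ 2 * μ = (μ ^ (r - 1 / 2)) ^ 2 := by
        rw [← Real.rpow_natCast, ← Real.rpow_natCast, ← Real.rpow_mul hμ.le, ← Real.rpow_mul hμ.le]
        conv_lhs => rw [← Real.rpow_one μ, ← Real.rpow_mul hμ.le, ← Real.rpow_add hμ]
        congr 1; push_cast; ring
      have e2 : (l * l ^ (r - 1 / 2 - 1)) ^ 2 = l ^ (2 * r - 1) := by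
        rw [mul_comm, ← Real.rpow_add_one hl.ne', ← Real.rpow_natCast, ← Real.rpow_mul hl.le]
        congr 1; push_cast; ring
      have hml : 0 < μ + l := by linarith
      rw [hsq, ← mul_assoc]
      refine mul_le_mul_of_nonneg_right ?_ (sq_nonneg _)
      rw [← e2, div_pow, mul_pow, div_mul_eq_mul_div, div_le_iff₀ (by positivity), mul_assoc, e1,
        ← mul_pow, ← mul_pow, mul_assoc]
      gcongr
  have hvn : ∀ μ, ‖v μ‖ ^ 2 ≤ l ^ (2 * r - 2) * ‖p μ‖ ^ 2 := by
    intro μ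
    have hsq : ‖v μ‖ ^ 2 = (μ ^ r / (μ + l)) ^ 2 * ‖p μ‖ ^ 2 := by
      rw [norm_smul, mul_pow, Real.norm_eq_abs, sq_abs]
    rcases lt_or_ge μ 0 with hμ | hμ
    · rw [hsq, hneg μ hμ]; simp
    · have hy := rpow_le_rpow_sub_one_mul_add (a := r) (by linarith) hr' hμ hl
      have e2 : (l ^ (r - 1)) ^ 2 = l ^ (2 * r - 2) := by
        rw [← Real.rpow_natCast, ← Real.rpow_mul hl.le]
        congr 1; push_cast; ring
      have hml : 0 < μ + l := by linarith
      rw [hsq]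
      refine mul_le_mul_of_nonneg_right ?_ (sq_nonneg _)
      rw [← e2, div_pow, div_le_iff₀ (by positivity), ← mul_pow]
      gcongr
  obtain ⟨hus, hub⟩ := summable_and_norm_tsum_sq_le (u := u) (C := l ^ (2 * r - 1) * ‖h‖ ^ 2)
    (fun μ ν hne => by
      change ⟪_ • S.adjoint (p μ), _ • S.adjoint (p ν)⟫ = 0
      rw [real_inner_smul_left, real_inner_smul_right, hin, show ⟪p μ, p ν⟫ = 0 from horth hne]
      simp)
    (fun s => (Finset.sum_le_sum fun μ _ => hun μ).trans (by
      rw [← Finset.mul_sum]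
      exact mul_le_mul_of_nonneg_left (hBes s) (Real.rpow_nonneg hl.le _)))
  obtain ⟨hvs, hvb⟩ := summable_and_norm_tsum_sq_le (u := v) (C := l ^ (2 * r - 2) * ‖h‖ ^ 2)
    (fun μ ν hne => by
      change ⟪_ • p μ, _ • p ν⟫ = 0
      rw [real_inner_smul_left, real_inner_smul_right, show ⟪p μ, p ν⟫ = 0 from horth hne]
      simp)
    (fun s => (Finset.sum_le_sum fun μ _ => hvn μ).trans (by
      rw [← Finset.mul_sum]
      exact mul_le_mul_of_nonneg_left (hBes s) (Real.rpow_nonneg hl.le _)))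
  refine ⟨∑' μ, u μ, ∑' μ, v μ, ?_, hub, hvb⟩
  rw [map_add, hSS, S.map_tsum hus, A.map_tsum hvs,
    ← (hus.mapL S).tsum_add (hvs.mapL A), spectralPow]
  refine tsum_congr fun μ => ?_
  change S (_ • S.adjoint (p μ)) + A (_ • p μ) = μ ^ r • p μ
  rw [map_smul, map_smul, hSS, hAp, smul_smul, smul_smul, ← add_smul]
  rcases lt_trichotomy μ 0 with hμ | hμ | hμ
  · rw [hneg μ hμ]; simp
  · rw [hμ, Real.zero_rpow (show r ≠ 0 by linarith)]; simp
  · have e : μ ^ (r - 1) * μ = μ ^ r := by rw [← Real.rpow_add_one hμ.ne']; simp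
    congr 1
    have hml : μ + l ≠ 0 := by linarith
    field_simp
    linear_combination l * e

end Spectral

/-! ### The ridge regression estimator in closed form -/

section Estimator

variable {X : Type*} {H : Type*} [NormedAddCommGroup H] [InnerProductSpace ℝ H] [CompleteSpace H]
  [RKHS ℝ H X ℝ]

theorem krr_eq_sampleInv {n : ℕ} (hn : 0 < n) (D : Fin n → X × ℝ) {l : ℝ} (hl : 0 < l) :
    krr H D l = sampleInv (fun z : X × ℝ => kernelSection H z.1) (n * l) D
      (∑ i, (D i).2 • kernelSection H (D i).1) := by
  have hn' : (0 : ℝ) < n := Nat.cast_pos.2 hn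
  set f₀ := sampleInv (fun z : X × ℝ => kernelSection H z.1) (n * l) D
    (∑ i, (D i).2 • kernelSection H (D i).1) with hf₀
  refine (existsUnique_krrObjective_min (H := H) D hl).unique (krr_spec H D hl) fun g => ?_
  have hspec := regInv_spec (isPositive_covOp fun i => kernelSection H (D i).1) (mul_pos hn' hl)
    (∑ i, (D i).2 • kernelSection H (D i).1)
  change (n * l) • f₀ + covOp _ f₀ = _ at hspec
  have hd := congrArg (fun u => ⟪u, g - f₀⟫) hspec
  simp only [inner_add_left, covOp_apply, sum_inner, real_inner_smul_left,
    inner_kernelSection] at hd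
  set d := g - f₀ with hd'
  have hg : g = f₀ + d := by rw [hd']; abel
  have hsum : ∑ i, (g (D i).1 - (D i).2) ^ 2 = ∑ i, (f₀ (D i).1 - (D i).2) ^ 2
      + 2 * ∑ i, f₀ (D i).1 * d (D i).1 - 2 * ∑ i, (D i).2 * d (D i).1
      + ∑ i, d (D i).1 ^ 2 := by
    rw [Finset.mul_sum, Finset.mul_sum, ← Finset.sum_add_distrib, ← Finset.sum_sub_distrib,
      ← Finset.sum_add_distrib]
    refine Finset.sum_congr rfl fun i _ => ?_
    rw [hg, RKHS.coe_add, Pi.add_apply]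
    ring
  have hnorm : ‖g‖ ^ 2 = ‖f₀‖ ^ 2 + 2 * ⟪f₀, d⟫ + ‖d‖ ^ 2 := by rw [hg, norm_add_sq_real]
  have hpos : 0 ≤ (1 / n : ℝ) * ∑ i, d (D i).1 ^ 2 :=
    mul_nonneg (by positivity) (Finset.sum_nonneg fun i _ => sq_nonneg _)
  have hpos' : 0 ≤ l * ‖d‖ ^ 2 := by positivity
  have hn1 : (1 / n : ℝ) * n = 1 := by field_simp
  unfold krrObjective
  rw [hsum, hnorm]
  have hkey : (1 / n : ℝ) * (2 * ∑ i, f₀ (D i).1 * d (D i).1 - 2 * ∑ i, (D i).2 * d (D i).1) +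
      l * (2 * ⟪f₀, d⟫) = 0 := by
    rw [← hd]
    linear_combination (-2 * l * ⟪f₀, d⟫) * hn1
  linarith

/-- The error of the estimator relative to any `f` splits into a term that depends on the noise
`y - f(x)` and a bias term that depends on the inputs only. -/
theorem krr_sub_eq {n : ℕ} (hn : 0 < n) (D : Fin n → X × ℝ) {l : ℝ} (hl : 0 < l) (f : H) :
    krr H D l - f =
      ∑ i, ((D i).2 - f (D i).1) • sampleInv (fun z : X × ℝ => kernelSection H z.1) (n * l) D
        (kernelSection H (D i).1) -
      (n * l) • sampleInv (fun z : X × ℝ => kernelSection H z.1) (n * l) D f := by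
  have hτ : (0 : ℝ) < n * l := mul_pos (Nat.cast_pos.2 hn) hl
  have h := regInv_spec' (isPositive_covOp fun i => kernelSection H (D i).1) hτ f
  rw [covOp_apply, map_add, map_smul] at h
  simp only [inner_kernelSection, map_sum, map_smul] at h
  rw [krr_eq_sampleInv hn D hl]
  simp only [map_sum, map_smul, sub_smul, Finset.sum_sub_distrib]
  change ∑ i, _ - f = ∑ i, _ - ∑ i, f (D i).1 • regInv (covOp fun i => kernelSection H (D i).1)
    (n * l) (kernelSection H (D i).1) - (n * l) • regInv (covOp fun i => kernelSection H (D i).1)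
    (n * l) f
  nth_rewrite 1 [← h]
  abel

theorem continuous_dkrr [MetricSpace X]
    (hK : Continuous (Function.uncurry (reproducingKernel H))) {l : ℝ} (hl : 0 < l) {m : ℕ} {n : Fin m → ℕ} (hn : ∀ j, 0 < n j) :
    Continuous fun D : (Σ j : Fin m, Fin (n j)) → X × ℝ => dkrr H D fun _ => l := by
  have hφ := continuous_kernelSection_fst hK
  unfold dkrr
  refine continuous_finsetSum _ fun j _ => Continuous.const_smul ?_ _
  simp only [krr_eq_sampleInv (hn j) _ hl]
  have h1 := continuous_sampleInv (ι := Fin (n j)) hφ (mul_pos (Nat.cast_pos.2 (hn j)) hl)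
  have h2 : Continuous fun D : (Σ j : Fin m, Fin (n j)) → X × ℝ => fun i => D ⟨j, i⟩ := by fun_prop
  refine (h1.comp h2).clm_apply (continuous_finsetSum _ fun i _ => ?_)
  exact (continuous_snd.comp (continuous_apply _)).smul (hφ.comp (continuous_apply _))

end Estimator

/-! ### Centred noise and the regression function -/

section Noise

variable {X : Type*} [MetricSpace X] [CompactSpace X] [MeasurableSpace X] [BorelSpace X]
  (ρ : Measure (X × ℝ)) [IsProbabilityMeasure ρ]

theorem ae_forall_of_ae {Z ι : Type*} [MeasurableSpace Z] [Fintype ι] {P : Measure Z}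
    [IsProbabilityMeasure P] {p : Z → Prop} (h : ∀ᵐ z ∂P, p z) :
    ∀ᵐ D : ι → Z ∂(Measure.pi fun _ => P), ∀ i, p (D i) :=
  ae_all_iff.2 fun i =>
    (measurePreserving_eval (fun _ : ι => P) i).quasiMeasurePreserving.tendsto_ae.eventually h

/-- Sums of vectors that depend on the inputs only, with coefficients the noise variables, have
uncorrelated summands: resampling one coordinate makes each mixed term an integral of centred
noise. -/
theorem integrable_and_integral_norm_sum_noise_le {ι : Type*} [Fintype ι] {F : Type*}
    [NormedAddCommGroup F] [InnerProductSpace ℝ F] {ε : X × ℝ → ℝ} (hε : Continuous ε) {C : ℝ}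
    (hC : ∀ᵐ z ∂ρ, |ε z| ≤ C)
    (h0 : ∀ ψ : X → ℝ, Continuous ψ → ∫ z, ε z * ψ z.1 ∂ρ = 0) {G : ι → (ι → X) → F}
    (hG : ∀ a, Continuous (G a)) :
    Integrable (fun D : ι → X × ℝ => ‖∑ a, ε (D a) • G a (fun k => (D k).1)‖ ^ 2)
        (Measure.pi fun _ => ρ) ∧
      ∫ D : ι → X × ℝ, ‖∑ a, ε (D a) • G a (fun k => (D k).1)‖ ^ 2 ∂(Measure.pi fun _ => ρ) ≤
        C ^ 2 * ∫ D : ι → X × ℝ, ∑ a, ‖G a (fun k => (D k).1)‖ ^ 2 ∂(Measure.pi fun _ => ρ) := by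
  classical
  set P : Measure (ι → X × ℝ) := Measure.pi fun _ => ρ with hP
  have hCall : ∀ᵐ D ∂P, ∀ a, |ε (D a)| ≤ C := ae_forall_of_ae hC
  have hterm : ∀ (a b : ι) (Ψ : (ι → X) → ℝ), Continuous Ψ →
      Integrable (fun D : ι → X × ℝ => ε (D a) * (ε (D b) * Ψ fun k => (D k).1)) P := by
    intro a b Ψ hΨ
    obtain ⟨B, hB⟩ := isCompact_univ.exists_bound_of_continuousOn hΨ.continuousOn
    refine Integrable.of_bound (C := C * (C * B))
      (Continuous.aestronglyMeasurable (by fun_prop)) ?_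
    filter_upwards [hCall] with D hD
    have hC0 : 0 ≤ C := (abs_nonneg _).trans (hD a)
    rw [norm_mul, norm_mul]
    exact mul_le_mul (hD a) (mul_le_mul (hD b) (hB _ trivial) (norm_nonneg _) hC0)
      (by positivity) hC0
  have hcross : ∀ (a b : ι) (Ψ : (ι → X) → ℝ), Continuous Ψ → a ≠ b →
      ∫ D : ι → X × ℝ, ε (D a) * (ε (D b) * Ψ fun k => (D k).1) ∂P = 0 := by
    intro a b Ψ hΨ hab
    have hmp := measurePreserving_update ρ (ι := ι) a
    have hi := hterm a b Ψ hΨ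
    have hm := hi.aestronglyMeasurable
    rw [hP, ← hmp.map_eq] at hm
    have h := integral_map hmp.measurable.aemeasurable hm
    rw [hmp.map_eq] at h
    have hi' := (hmp.integrable_comp hi.aestronglyMeasurable).2 hi
    refine h.trans ((integral_prod _ hi').trans ?_)
    refine integral_eq_zero_of_ae (.of_forall fun D => ?_)
    have hψ : Continuous fun x : X => Ψ (Function.update (fun k => (D k).1) a x) :=
      hΨ.comp (continuous_const.update a continuous_id)
    have := h0 _ hψ
    simp only [Function.comp_apply, Function.update_self, Function.update_of_ne hab.symm,
      Pi.zero_apply]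
    calc ∫ z, ε z * (ε (D b) * Ψ fun k => (Function.update D a z k).1) ∂ρ
        = ∫ z, ε (D b) * (ε z * Ψ (Function.update (fun k => (D k).1) a z.1)) ∂ρ := by
          refine integral_congr_ae (.of_forall fun z => ?_)
          have : (fun k => (Function.update D a z k).1) =
              Function.update (fun k => (D k).1) a z.1 := by
            funext k
            by_cases hk : k = a
            · subst hk; simp
            · simp [hk]
          simp only [this]
          ring
      _ = 0 := by rw [integral_const_mul, this, mul_zero]
  have hexp : ∀ D : ι → X × ℝ, ‖∑ a, ε (D a) • G a (fun k => (D k).1)‖ ^ 2 =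
      ∑ a, ∑ b, ε (D a) * (ε (D b) * ⟪G a (fun k => (D k).1), G b (fun k => (D k).1)⟫) := by
    intro D
    rw [← real_inner_self_eq_norm_sq, sum_inner]
    refine Finset.sum_congr rfl fun a _ => ?_
    rw [inner_sum]
    refine Finset.sum_congr rfl fun b _ => ?_
    rw [real_inner_smul_left, real_inner_smul_right]
  have hΨc : ∀ a b, Continuous fun ξ : ι → X => ⟪G a ξ, G b ξ⟫ := fun a b =>
    (hG a).inner (hG b)
  have hint : ∀ a b, Integrable (fun D : ι → X × ℝ =>
      ε (D a) * (ε (D b) * ⟪G a (fun k => (D k).1), G b (fun k => (D k).1)⟫)) P := fun a b =>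
    hterm a b _ (hΨc a b)
  have hGi : ∀ a, Integrable (fun D : ι → X × ℝ => ‖G a (fun k => (D k).1)‖ ^ 2) P := by
    intro a
    obtain ⟨B, hB⟩ := isCompact_univ.exists_bound_of_continuousOn ((hG a).norm.pow 2).continuousOn
    have hc := hG a
    exact Integrable.of_bound (C := B) (Continuous.aestronglyMeasurable (by fun_prop))
      (.of_forall fun D => hB _ trivial)
  simp only [hexp]
  refine ⟨integrable_finsetSum _ fun a _ => integrable_finsetSum _ fun b _ => hint a b, ?_⟩
  rw [integral_finsetSum _ fun a _ => integrable_finsetSum _ fun b _ => hint a b,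
    integral_finsetSum _ fun a _ => hGi a, Finset.mul_sum]
  refine Finset.sum_le_sum fun a _ => ?_
  rw [integral_finsetSum _ fun b _ => hint a b, Finset.sum_eq_single a
    (fun b _ hne => hcross a b _ (hΨc a b) hne.symm) (fun h => absurd (Finset.mem_univ a) h),
    ← integral_const_mul]
  refine integral_mono_ae (hint a a) ((hGi a).const_mul _) ?_
  filter_upwards [hCall] with D hD
  rw [real_inner_self_eq_norm_sq, ← mul_assoc, ← sq, ← sq_abs]
  exact mul_le_mul_of_nonneg_right (pow_le_pow_left₀ (abs_nonneg _) (hD a) 2) (sq_nonneg _)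

variable {M : ℝ} (hbdd : ∀ᵐ z ∂ρ, |z.2| ≤ M)

include hbdd

theorem ae_abs_regressionFunction_le : ∀ᵐ x ∂ρ.fst, |regressionFunction ρ x| ≤ M := by
  have h : ∀ᵐ z ∂(ρ.fst ⊗ₘ ρ.condKernel), |z.2| ≤ M := by rwa [ρ.disintegrate ρ.condKernel]
  filter_upwards [Measure.ae_ae_of_ae_compProd h] with x hx
  have := norm_integral_le_of_norm_le_const (μ := ρ.condKernel x) (f := fun y : ℝ => y) (C := M) hx
  simpa [regressionFunction] using this

theorem integral_noise_mul_eq_zero {f : X → ℝ} (hf : Continuous f)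
    (hfr : regressionFunction ρ =ᵐ[ρ.fst] f) {ψ : X → ℝ} (hψ : Continuous ψ) :
    ∫ z, (z.2 - f z.1) * ψ z.1 ∂ρ = 0 := by
  obtain ⟨B, hB⟩ := isCompact_univ.exists_bound_of_continuousOn hψ.continuousOn
  have hi1 : Integrable (fun z : X × ℝ => z.2 * ψ z.1) ρ := by
    refine Integrable.of_bound (C := M * B) (Continuous.aestronglyMeasurable (by fun_prop)) ?_
    filter_upwards [hbdd] with z hz
    rw [norm_mul]
    exact mul_le_mul hz (hB _ trivial) (norm_nonneg _) ((abs_nonneg _).trans hz)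
  have hi2 : Integrable (fun z : X × ℝ => f z.1 * ψ z.1) ρ := by
    obtain ⟨B', hB'⟩ := isCompact_univ.exists_bound_of_continuousOn (hf.mul hψ).continuousOn
    exact Integrable.of_bound (C := B') (Continuous.aestronglyMeasurable (by fun_prop))
      (.of_forall fun z => hB' _ trivial)
  simp only [sub_mul]
  rw [integral_sub hi1 hi2, sub_eq_zero, ← Measure.integral_condKernel hi1,
    ← integral_map (f := fun x => f x * ψ x) measurable_fst.aemeasurable
      (hf.mul hψ).aestronglyMeasurable]
  refine integral_congr_ae ?_
  filter_upwards [hfr] with x hx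
  rw [integral_mul_const, ← hx]
  rfl

end Noise

/-! ### Bias and variance of the distributed estimator -/

section Error

variable {X : Type*} [MetricSpace X] [CompactSpace X] [MeasurableSpace X] [BorelSpace X]
  {H : Type*} [NormedAddCommGroup H] [InnerProductSpace ℝ H] [CompleteSpace H] [RKHS ℝ H X ℝ]
  (hK : Continuous (Function.uncurry (reproducingKernel H)))
  (ρ : Measure (X × ℝ)) [IsProbabilityMeasure ρ] {κ l c : ℝ}

include hK

theorem integrable_norm_inclusionL2_sampleInv_sq {ι : Type*} [Fintype ι]
    {τ : ℝ} (hτ : 0 < τ) (u : H) :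
    Integrable (fun D : ι → X × ℝ => ‖inclusionL2 hK ρ.fst
      (sampleInv (fun z : X × ℝ => kernelSection H z.1) τ D u)‖ ^ 2) (Measure.pi fun _ => ρ) := by
  have hRc := continuous_sampleInv (ι := ι) (continuous_kernelSection_fst hK) hτ
  set S := inclusionL2 hK ρ.fst
  refine Integrable.of_bound (C := (‖S‖ * (‖u‖ / τ)) ^ 2)
    (Continuous.aestronglyMeasurable (by fun_prop)) (.of_forall fun D => ?_)
  rw [Real.norm_of_nonneg (by positivity)]
  exact pow_le_pow_left₀ (norm_nonneg _) ((S.le_opNorm _).trans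
    (mul_le_mul_of_nonneg_left (norm_regInv_le (isPositive_covOp _) hτ _) (norm_nonneg _))) 2

/-- The expected squared bias at `f + S† g`. -/
theorem integral_bias_le {ι : Type*} [Fintype ι] [Nonempty ι]
    (hκ : ∀ x : X, ‖kernelSection H x‖ ≤ κ) (hl : 0 < l)
    (hc : 1 + κ ^ 2 / (Fintype.card ι * l) ≤ c) (f : H) (g : Lp ℝ 2 ρ.fst) :
    (Fintype.card ι * l) ^ 2 * ∫ D : ι → X × ℝ, ‖inclusionL2 hK ρ.fst
        (sampleInv (fun z : X × ℝ => kernelSection H z.1) (Fintype.card ι * l) D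
          (f + (inclusionL2 hK ρ.fst).adjoint g))‖ ^ 2 ∂(Measure.pi fun _ => ρ) ≤
      2 * (c ^ 2 * (l * ‖f‖ ^ 2)) + 2 * (c ^ 4 * (l ^ 2 * ‖g‖ ^ 2)) := by
  have hn : (0 : ℝ) < (Fintype.card ι : ℝ) := by simp [Fintype.card_pos]
  have hτ := mul_pos hn hl
  have hφ := continuous_kernelSection_fst hK
  have hadj := card_mul_integral_adjoint_le (ι := ι) hK ρ hκ hτ g
  have hloo := fun u : H => card_mul_integral_sampleInv_sq_le (ι := ι) ρ hφ
    (fun z => hκ z.1) hτ u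
  have hI := fun u : H => integrable_inner_sampleInv (ι := ι) ρ hφ hτ u
  simp only [integral_inner_kernelSection_sq hK] at hloo
  have hint := fun u : H => integrable_norm_inclusionL2_sampleInv_sq (ι := ι) hK ρ hτ u
  generalize (Fintype.card ι : ℝ) = n at *
  set S := inclusionL2 hK ρ.fst
  set R := fun D : ι → X × ℝ => sampleInv (fun z : X × ℝ => kernelSection H z.1) (n * l) D
  set Q := fun u : H => ∫ D : ι → X × ℝ, ‖S (R D u)‖ ^ 2 ∂(Measure.pi fun _ => ρ)
  have hc1 : 1 + κ ^ 2 / (n * l) ≥ 0 := by positivity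
  have hc2 : (1 + κ ^ 2 / (n * l)) ^ 2 ≤ c ^ 2 := pow_le_pow_left₀ hc1 hc 2
  have hsplit : Q (f + S.adjoint g) ≤ 2 * Q f + 2 * Q (S.adjoint g) := by
    simp only [Q]
    rw [← integral_const_mul, ← integral_const_mul,
      ← integral_add ((hint f).const_mul 2) ((hint _).const_mul 2)]
    refine integral_mono (hint _) (((hint f).const_mul 2).add ((hint _).const_mul 2)) fun D => ?_
    simp only [map_add]
    have h := parallelogram_law_with_norm ℝ (S (R D f)) (S (R D (S.adjoint g)))
    have h2 := mul_self_nonneg ‖S (R D f) - S (R D (S.adjoint g))‖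
    simp only [R] at h h2
    nlinarith
  have hQf : n * Q f ≤ c ^ 2 * (‖f‖ ^ 2 / (n * l)) := by
    refine (hloo f).trans (mul_le_mul hc2 ?_ (integral_nonneg fun D =>
      inner_regInv_nonneg (isPositive_covOp _) hτ f) (sq_nonneg c))
    refine (integral_mono (hI f) (integrable_const (‖f‖ ^ 2 / (n * l))) fun D =>
      inner_regInv_le (isPositive_covOp _) hτ f).trans (le_of_eq ?_)
    simp
  have hQg : n * (n * Q (S.adjoint g)) ≤ c ^ 4 * ‖g‖ ^ 2 := by
    calc n * (n * Q (S.adjoint g)) ≤ n * (c ^ 2 * ∫ D : ι → X × ℝ,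
          ⟪S.adjoint g, R D (S.adjoint g)⟫ ∂(Measure.pi fun _ => ρ)) := by
          refine mul_le_mul_of_nonneg_left ((hloo _).trans ?_) hn.le
          exact mul_le_mul_of_nonneg_right hc2 (integral_nonneg fun D =>
            inner_regInv_nonneg (isPositive_covOp _) hτ _)
      _ = c ^ 2 * (n * ∫ D : ι → X × ℝ,
          ⟪S.adjoint g, R D (S.adjoint g)⟫ ∂(Measure.pi fun _ => ρ)) := by ring
      _ ≤ c ^ 2 * (c ^ 2 * ‖g‖ ^ 2) := by
          refine mul_le_mul_of_nonneg_left (hadj.trans ?_) (sq_nonneg c)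
          exact mul_le_mul_of_nonneg_right hc2 (sq_nonneg _)
      _ = c ^ 4 * ‖g‖ ^ 2 := by ring
  have h1 : (n * l) ^ 2 * Q f ≤ c ^ 2 * (l * ‖f‖ ^ 2) := by
    have := mul_le_mul_of_nonneg_left hQf (by positivity : 0 ≤ n * l ^ 2)
    calc (n * l) ^ 2 * Q f = n * l ^ 2 * (n * Q f) := by ring
      _ ≤ _ := this
      _ = c ^ 2 * (l * ‖f‖ ^ 2) := by field_simp
  have h2 : (n * l) ^ 2 * Q (S.adjoint g) ≤ c ^ 4 * (l ^ 2 * ‖g‖ ^ 2) := by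
    have := mul_le_mul_of_nonneg_left hQg (sq_nonneg l)
    linarith
  have h3 := mul_le_mul_of_nonneg_left hsplit (sq_nonneg (n * l))
  change (n * l) ^ 2 * Q (f + S.adjoint g) ≤ _
  linarith

end Error

/-! ### The excess error of the averaged estimator -/

section Main

variable {X : Type*} [MetricSpace X] [CompactSpace X] [MeasurableSpace X] [BorelSpace X]
  {H : Type*} [NormedAddCommGroup H] [InnerProductSpace ℝ H] [CompleteSpace H] [RKHS ℝ H X ℝ]
  (hK : Continuous (Function.uncurry (reproducingKernel H)))
  (ρ : Measure (X × ℝ)) [IsProbabilityMeasure ρ] {κ l c : ℝ}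

theorem excessError_eq_norm_sq {f : H} (hf : regressionFunction ρ =ᵐ[ρ.fst] f) (g : H) :
    excessError ρ g = ‖inclusionL2 hK ρ.fst (g - f)‖ ^ 2 := by
  rw [norm_inclusionL2_sq]
  refine integral_congr_ae ?_
  filter_upwards [hf] with x hx
  rw [hx, RKHS.coe_sub, Pi.sub_apply]

theorem sq_norm_sum_smul_le {F ι : Type*} [NormedAddCommGroup F] [NormedSpace ℝ F] (s : Finset ι)
    {w : ι → ℝ} (hw : ∀ i ∈ s, 0 ≤ w i) (hw1 : ∑ i ∈ s, w i = 1) (v : ι → F) :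
    ‖∑ i ∈ s, w i • v i‖ ^ 2 ≤ ∑ i ∈ s, w i * ‖v i‖ ^ 2 := by
  have h : ‖∑ i ∈ s, w i • v i‖ ≤ ∑ i ∈ s, w i * ‖v i‖ := by
    refine (norm_sum_le _ _).trans (le_of_eq (Finset.sum_congr rfl fun i hi => ?_))
    rw [norm_smul, Real.norm_of_nonneg (hw i hi)]
  exact (pow_le_pow_left₀ (norm_nonneg _) h 2).trans
    (Real.pow_arith_mean_le_arith_mean_pow s w _ hw hw1 (fun i _ => norm_nonneg _) 2)

/-- The lower bound on the local sample sizes keeps `n l` away from zero. -/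
theorem le_card_mul_of_rpow_mul_log_le {N n : ℕ} (hn : 0 < n) (hnN : n ≤ N) {α C₁ : ℝ}
    (hC₁ : 0 < C₁) (h : (N : ℝ) ^ α * Real.log N ^ 4 ≤ n) :
    C₁ * min 1 (Real.log 2 ^ 4) ≤ n * (C₁ * (N : ℝ) ^ (-α)) := by
  have hN : 0 < N := hn.trans_le hnN
  have hN' : (0 : ℝ) < N := Nat.cast_pos.2 hN
  have hpow : (N : ℝ) ^ α * (N : ℝ) ^ (-α) = 1 := by rw [← Real.rpow_add hN']; simp
  have hkey : min 1 (Real.log 2 ^ 4) ≤ n * (N : ℝ) ^ (-α) := by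
    rcases Nat.lt_or_ge N 2 with h2 | h2
    · -- For `N = 1` the logarithm vanishes, and the bound comes from `1 ≤ n`.
      have hN1 : N = 1 := by omega
      have : (1 : ℝ) ≤ n := Nat.one_le_cast.2 hn
      simp [hN1, this]
    · have hlog : Real.log 2 ≤ Real.log N := Real.log_le_log two_pos (by exact_mod_cast h2)
      have hlog2 : 0 ≤ Real.log 2 := (Real.log_pos one_lt_two).le
      have h3 := mul_le_mul_of_nonneg_right h (Real.rpow_nonneg hN'.le (-α))
      calc min 1 (Real.log 2 ^ 4) ≤ Real.log 2 ^ 4 := min_le_right _ _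
        _ ≤ Real.log N ^ 4 := pow_le_pow_left₀ hlog2 hlog 4
        _ = (N : ℝ) ^ α * Real.log N ^ 4 * (N : ℝ) ^ (-α) := by
            linear_combination -Real.log N ^ 4 * hpow
        _ ≤ _ := h3
  calc _ ≤ C₁ * (n * (N : ℝ) ^ (-α)) := mul_le_mul_of_nonneg_left hkey hC₁.le
    _ = _ := by ring

theorem integral_comp_block {Z : Type*} [MeasurableSpace Z] (P : Measure Z) [IsProbabilityMeasure P]
    {m : ℕ} {n : Fin m → ℕ} (j : Fin m) {F : (Fin (n j) → Z) → ℝ}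
    (hF : Integrable F (Measure.pi fun _ => P)) :
    Integrable (fun D : (Σ j : Fin m, Fin (n j)) → Z => F fun i => D ⟨j, i⟩)
        (Measure.pi fun _ => P) ∧
      ∫ D : (Σ j : Fin m, Fin (n j)) → Z, F (fun i => D ⟨j, i⟩) ∂(Measure.pi fun _ => P) =
        ∫ D, F D ∂(Measure.pi fun _ => P) := by
  have hmp : MeasurePreserving (fun (D : (Σ j : Fin m, Fin (n j)) → Z) i => D ⟨j, i⟩)
      (Measure.pi fun _ => P) (Measure.pi fun _ => P) :=
    measurePreserving_comp_of_injective P sigma_mk_injective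
  have hm := hF.aestronglyMeasurable
  rw [← hmp.map_eq] at hm
  have h := integral_map hmp.measurable.aemeasurable hm
  rw [hmp.map_eq] at h
  exact ⟨hmp.integrable_comp_of_integrable hF, h.symm⟩

include hK

theorem integrable_sum_norm_inclusionL2_sampleInv_sq (hκ : ∀ x : X, ‖kernelSection H x‖ ≤ κ)
    {ι : Type*} [Fintype ι] {τ : ℝ} (hτ : 0 < τ) :
    Integrable (fun D : ι → X × ℝ => ∑ i, ‖inclusionL2 hK ρ.fst
      (sampleInv (fun z : X × ℝ => kernelSection H z.1) τ D (kernelSection H (D i).1))‖ ^ 2)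
      (Measure.pi fun _ => ρ) := by
  set S := inclusionL2 hK ρ.fst
  have hφ := continuous_kernelSection_fst hK
  refine integrable_finsetSum _ fun i _ => ?_
  have hc : Continuous fun D : ι → X × ℝ =>
      S (sampleInv (fun z : X × ℝ => kernelSection H z.1) τ D (kernelSection H (D i).1)) :=
    S.continuous.comp ((continuous_sampleInv hφ hτ).clm_apply (hφ.comp (continuous_apply i)))
  refine Integrable.of_bound (C := (‖S‖ * (κ / τ)) ^ 2)
    (hc.norm.pow 2).aestronglyMeasurable (.of_forall fun D => ?_)
  rw [Real.norm_of_nonneg (by positivity)]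
  refine pow_le_pow_left₀ (norm_nonneg _) ((S.le_opNorm _).trans ?_) 2
  refine mul_le_mul_of_nonneg_left ((norm_regInv_le (isPositive_covOp _) hτ _).trans ?_)
    (norm_nonneg _)
  exact div_le_div_of_nonneg_right (hκ _) hτ.le

/-- The averaged noise term. The local variances are of order `T / n j`, and the weights `n j / N`
enter squared because the noise is uncorrelated, so they add up to order `T / N`. -/
theorem integrable_and_integral_norm_sq_noise_le (hκ : ∀ x : X, ‖kernelSection H x‖ ≤ κ)
    (hl : 0 < l) {m : ℕ} (hm : 0 < m) {n : Fin m → ℕ} (hn : ∀ j, 0 < n j)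
    (hc : ∀ j, 1 + κ ^ 2 / (n j * l) ≤ c) {T : ℝ} (hT : 0 ≤ T)
    (heff : effectiveDimension (integralOperator ρ.fst hK) l ≤ ENNReal.ofReal T)
    {ε : X × ℝ → ℝ} (hε : Continuous ε) {C : ℝ} (hC : ∀ᵐ z ∂ρ, |ε z| ≤ C)
    (h0 : ∀ ψ : X → ℝ, Continuous ψ → ∫ z, ε z * ψ z.1 ∂ρ = 0) :
    Integrable (fun D : (Σ j : Fin m, Fin (n j)) → X × ℝ => ‖∑ j,
        ((n j : ℝ) / (∑ k, n k : ℕ)) • ∑ i, ε (D ⟨j, i⟩) • inclusionL2 hK ρ.fst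
          (sampleInv (fun z : X × ℝ => kernelSection H z.1) (n j * l) (fun i => D ⟨j, i⟩)
            (kernelSection H (D ⟨j, i⟩).1))‖ ^ 2) (Measure.pi fun _ => ρ) ∧
      ∫ D : (Σ j : Fin m, Fin (n j)) → X × ℝ, ‖∑ j,
        ((n j : ℝ) / (∑ k, n k : ℕ)) • ∑ i, ε (D ⟨j, i⟩) • inclusionL2 hK ρ.fst
          (sampleInv (fun z : X × ℝ => kernelSection H z.1) (n j * l) (fun i => D ⟨j, i⟩)
            (kernelSection H (D ⟨j, i⟩).1))‖ ^ 2 ∂(Measure.pi fun _ => ρ) ≤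
        C ^ 2 * (2 * c ^ 2 * T / (∑ k, n k : ℕ)) := by
  have hn' : ∀ j, (0 : ℝ) < n j := fun j => Nat.cast_pos.2 (hn j)
  have hne : ∀ j, Nonempty (Fin (n j)) := fun j => ⟨⟨0, hn j⟩⟩
  have hNsum : ((∑ j, n j : ℕ) : ℝ) = ∑ j, (n j : ℝ) := by push_cast; rfl
  generalize ((∑ j, n j : ℕ) : ℝ) = N at *
  have hN0 : 0 < N := by
    rw [hNsum]
    exact Finset.sum_pos (fun j _ => hn' j) ⟨⟨0, hm⟩, Finset.mem_univ _⟩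
  have hτ : ∀ j, 0 < n j * l := fun j => mul_pos (hn' j) hl
  have hks := continuous_kernelSection hK
  set S := inclusionL2 hK ρ.fst
  set P : Measure ((Σ j : Fin m, Fin (n j)) → X × ℝ) := Measure.pi fun _ => ρ
  set U : ∀ j, (Fin (n j) → X × ℝ) → Fin (n j) → Lp ℝ 2 ρ.fst := fun j D i =>
    S (sampleInv (fun z : X × ℝ => kernelSection H z.1) (n j * l) D (kernelSection H (D i).1))
  -- The vectors multiplying the noise variables, as functions of the inputs.
  set G : (Σ j : Fin m, Fin (n j)) → ((Σ j : Fin m, Fin (n j)) → X) → Lp ℝ 2 ρ.fst :=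
    fun a ξ => (n a.1 / N) • S (sampleInv (kernelSection H) (n a.1 * l) (fun i => ξ ⟨a.1, i⟩)
      (kernelSection H (ξ a)))
  have hGU : ∀ (D : (Σ j : Fin m, Fin (n j)) → X × ℝ) j i, G ⟨j, i⟩ (fun k => (D k).1) =
      (n j / N) • U j (fun i => D ⟨j, i⟩) i := fun D j i => rfl
  have hGc : ∀ a, Continuous (G a) := by
    intro a
    have h1 := continuous_sampleInv (ι := Fin (n a.1)) hks (hτ a.1)
    have h2 : Continuous fun ξ : (Σ j : Fin m, Fin (n j)) → X => fun i => ξ ⟨a.1, i⟩ := by fun_prop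
    exact Continuous.const_smul
      (S.continuous.comp ((h1.comp h2).clm_apply (hks.comp (continuous_apply a))))
      (n a.1 / N : ℝ)
  obtain ⟨hVi, hVle⟩ := integrable_and_integral_norm_sum_noise_le ρ hε hC h0 hGc
  have hV : ∀ D : (Σ j : Fin m, Fin (n j)) → X × ℝ, ∑ a, ε (D a) • G a (fun k => (D k).1) =
      ∑ j, (n j / N) • ∑ i, ε (D ⟨j, i⟩) • U j (fun i => D ⟨j, i⟩) i := by
    intro D
    rw [Fintype.sum_sigma]
    refine Finset.sum_congr rfl fun j _ => ?_
    rw [Finset.smul_sum]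
    refine Finset.sum_congr rfl fun i _ => ?_
    rw [hGU, smul_comm]
  have hsum : ∀ D : (Σ j : Fin m, Fin (n j)) → X × ℝ, ∑ a, ‖G a fun k => (D k).1‖ ^ 2 =
      ∑ j, (n j / N) ^ 2 * ∑ i, ‖U j (fun i => D ⟨j, i⟩) i‖ ^ 2 := by
    intro D
    rw [Fintype.sum_sigma]
    refine Finset.sum_congr rfl fun j _ => ?_
    rw [Finset.mul_sum]
    refine Finset.sum_congr rfl fun i _ => ?_
    rw [hGU, norm_smul, mul_pow, Real.norm_eq_abs, sq_abs]
  simp only [hV, hsum] at hVi hVle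
  refine ⟨hVi, hVle.trans (mul_le_mul_of_nonneg_left ?_ (sq_nonneg C))⟩
  have hU := fun j => integrable_sum_norm_inclusionL2_sampleInv_sq (ι := Fin (n j)) hK ρ hκ (hτ j)
  have hj : ∀ j, n j * ∫ D, ∑ i, ‖U j (fun i => D ⟨j, i⟩) i‖ ^ 2 ∂P ≤ 2 * c ^ 2 * T := by
    intro j
    have h1 := (integral_comp_block ρ j (hU j)).2
    have h2 := card_mul_integral_sum_norm_sq_le (ι := Fin (n j)) hK ρ hκ hl hT heff
    rw [Fintype.card_fin, ← h1] at h2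
    refine h2.trans ?_
    have h3 : (0 : ℝ) ≤ 1 + κ ^ 2 / (n j * l) := by have := hτ j; positivity
    have h4 := pow_le_pow_left₀ h3 (hc j) 2
    gcongr
  rw [integral_finsetSum _ fun j _ => (integral_comp_block ρ j (hU j)).1.const_mul _]
  simp only [integral_const_mul]
  have h5 : ∑ j, (n j / N) ^ 2 * ∫ D, ∑ i, ‖U j (fun i => D ⟨j, i⟩) i‖ ^ 2 ∂P ≤
      ∑ j, n j * (2 * c ^ 2 * T / N ^ 2) := by
    refine Finset.sum_le_sum fun j _ => ?_
    have := mul_le_mul_of_nonneg_left (hj j) (by positivity : (0 : ℝ) ≤ n j / N ^ 2)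
    refine le_trans (le_of_eq ?_) (this.trans (le_of_eq ?_)) <;> ring
  rw [← Finset.sum_mul, ← hNsum] at h5
  refine h5.trans (le_of_eq ?_)
  field_simp

/-- The expected excess error of the averaged estimator, for a common regularization parameter
`l` and a regression function `f + S† g`. Averaging does not increase the bias, and it divides the
variance by the total sample size. -/
theorem integrable_and_integral_excessError_dkrr_le (hκ : ∀ x : X, ‖kernelSection H x‖ ≤ κ)
    {M : ℝ} (hbdd : ∀ᵐ z ∂ρ, |z.2| ≤ M) (hl : 0 < l) {m : ℕ} (hm : 0 < m) {n : Fin m → ℕ}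
    (hn : ∀ j, 0 < n j) (hc : ∀ j, 1 + κ ^ 2 / (n j * l) ≤ c) (f : H) (g : Lp ℝ 2 ρ.fst)
    (hfg : regressionFunction ρ =ᵐ[ρ.fst] ⇑(f + (inclusionL2 hK ρ.fst).adjoint g)) {T : ℝ}
    (hT : 0 ≤ T)
    (heff : effectiveDimension (integralOperator ρ.fst hK) l ≤ ENNReal.ofReal T) :
    Integrable (fun D : (Σ j : Fin m, Fin (n j)) → X × ℝ =>
        excessError ρ (dkrr H D fun _ => l)) (Measure.pi fun _ => ρ) ∧
      ∫ D : (Σ j : Fin m, Fin (n j)) → X × ℝ,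
          excessError ρ (dkrr H D fun _ => l) ∂(Measure.pi fun _ => ρ) ≤
        4 * (c ^ 2 * (l * ‖f‖ ^ 2)) + 4 * (c ^ 4 * (l ^ 2 * ‖g‖ ^ 2)) +
          16 * M ^ 2 * c ^ 2 * T / (∑ j, n j : ℕ) := by
  set S := inclusionL2 hK ρ.fst
  set fs := f + S.adjoint g with hfs
  have hn' : ∀ j, (0 : ℝ) < n j := fun j => Nat.cast_pos.2 (hn j)
  have hne : ∀ j, Nonempty (Fin (n j)) := fun j => ⟨⟨0, hn j⟩⟩
  have hτ : ∀ j, 0 < n j * l := fun j => mul_pos (hn' j) hl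
  have hfsc : Continuous (fs : X → ℝ) := continuous_coe hK fs
  set ε : X × ℝ → ℝ := fun z => z.2 - fs z.1
  have hεc : Continuous ε := by fun_prop
  have hεM : ∀ᵐ z ∂ρ, |ε z| ≤ 2 * M := by
    have h1 : ∀ᵐ x ∂ρ.fst, |fs x| ≤ M := by
      filter_upwards [ae_abs_regressionFunction_le ρ hbdd, hfg] with x hx hx'
      rwa [← hx']
    have h2 : ∀ᵐ z ∂ρ, |fs z.1| ≤ M := ae_of_ae_map measurable_fst.aemeasurable h1
    filter_upwards [hbdd, h2] with z hz hz'
    exact (abs_sub _ _).trans (by linarith)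
  have hVar := integrable_and_integral_norm_sq_noise_le hK ρ hκ hl hm hn hc hT heff hεc hεM
    fun ψ hψ => integral_noise_mul_eq_zero ρ hbdd hfsc hfg hψ
  have hdkrr := continuous_dkrr hK hl hn
  have hw1 : ∑ j, (n j : ℝ) / (∑ k, n k : ℕ) = 1 := by
    rw [← Finset.sum_div, ← Nat.cast_sum, div_self]
    exact Nat.cast_ne_zero.2
      (Finset.sum_pos (fun j _ => hn j) ⟨⟨0, hm⟩, Finset.mem_univ _⟩).ne'
  set w : Fin m → ℝ := fun j => (n j : ℝ) / (∑ k, n k : ℕ) with hw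
  have hw0 : ∀ j, 0 ≤ w j := fun j => by positivity
  set P : Measure ((Σ j : Fin m, Fin (n j)) → X × ℝ) := Measure.pi fun _ => ρ
  set R : ∀ j, (Fin (n j) → X × ℝ) → H →L[ℝ] H := fun j D =>
    sampleInv (fun z : X × ℝ => kernelSection H z.1) (n j * l) D
  set B : ∀ j, (Fin (n j) → X × ℝ) → Lp ℝ 2 ρ.fst := fun j D => (n j * l) • S (R j D fs) with hB
  set V : ((Σ j : Fin m, Fin (n j)) → X × ℝ) → Lp ℝ 2 ρ.fst := fun D => ∑ j, w j •
    ∑ i, ε (D ⟨j, i⟩) • S (R j (fun i => D ⟨j, i⟩) (kernelSection H (D ⟨j, i⟩).1))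
  obtain ⟨hVi, hVle⟩ : Integrable (fun D => ‖V D‖ ^ 2) P ∧ ∫ D, ‖V D‖ ^ 2 ∂P ≤ _ := hVar
  have hdecomp : ∀ D : (Σ j : Fin m, Fin (n j)) → X × ℝ,
      S (dkrr H D (fun _ => l) - fs) = V D - ∑ j, w j • B j fun i => D ⟨j, i⟩ := by
    intro D
    have h1 : dkrr H D (fun _ => l) - fs = ∑ j, w j • (krr H (fun i => D ⟨j, i⟩) l - fs) := by
      simp only [smul_sub, Finset.sum_sub_distrib]
      rw [← Finset.sum_smul, hw1, one_smul]
      rfl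
    rw [h1, map_sum, ← Finset.sum_sub_distrib]
    refine Finset.sum_congr rfl fun j _ => ?_
    rw [krr_sub_eq (hn j) _ hl, map_smul, map_sub, map_sum, smul_sub, map_smul]
    simp only [map_smul]
    rfl
  have hexc : ∀ D : (Σ j : Fin m, Fin (n j)) → X × ℝ, excessError ρ (dkrr H D fun _ => l) ≤
      2 * ‖V D‖ ^ 2 + 2 * ∑ j, w j * ‖B j fun i => D ⟨j, i⟩‖ ^ 2 := by
    intro D
    rw [excessError_eq_norm_sq hK ρ hfg, hdecomp]
    have h1 := sq_norm_sum_smul_le Finset.univ (fun j _ => hw0 j) hw1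
      fun j => B j fun i => D ⟨j, i⟩
    have h := parallelogram_law_with_norm ℝ (V D) (∑ j, w j • B j fun i => D ⟨j, i⟩)
    have h2 := mul_self_nonneg ‖V D + ∑ j, w j • B j fun i => D ⟨j, i⟩‖
    nlinarith
  have hBsq : ∀ j D, ‖B j D‖ ^ 2 = (n j * l) ^ 2 * ‖S (R j D fs)‖ ^ 2 := fun j D => by
    rw [hB, norm_smul, mul_pow, Real.norm_eq_abs, sq_abs]
  have hBi : ∀ j, Integrable (fun D : Fin (n j) → X × ℝ => ‖B j D‖ ^ 2)
      (Measure.pi fun _ => ρ) := by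
    intro j
    simp only [hBsq]
    exact (integrable_norm_inclusionL2_sampleInv_sq (ι := Fin (n j)) hK ρ (hτ j) fs).const_mul _
  have hBi' := fun j => (integral_comp_block ρ j (hBi j)).1
  have hBle : ∀ j, ∫ D, ‖B j fun i => D ⟨j, i⟩‖ ^ 2 ∂P ≤
      2 * (c ^ 2 * (l * ‖f‖ ^ 2)) + 2 * (c ^ 4 * (l ^ 2 * ‖g‖ ^ 2)) := by
    intro j
    rw [(integral_comp_block ρ j (hBi j)).2]
    simp only [hBsq]
    rw [integral_const_mul]
    have h2 := integral_bias_le (ι := Fin (n j)) (c := c) hK ρ hκ hl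
      (by rw [Fintype.card_fin]; exact hc j) f g
    rwa [Fintype.card_fin] at h2
  have hbi : Integrable (fun D : (Σ j : Fin m, Fin (n j)) → X × ℝ =>
      ∑ j, w j * ‖B j fun i => D ⟨j, i⟩‖ ^ 2) P :=
    integrable_finsetSum _ fun j _ => (hBi' j).const_mul (w j)
  have hbound := (hVi.const_mul 2).add (hbi.const_mul 2)
  have hint : Integrable (fun D : (Σ j : Fin m, Fin (n j)) → X × ℝ =>
      excessError ρ (dkrr H D fun _ => l)) P := by
    refine hbound.mono' ?_ (.of_forall fun D => ?_)
    · simp only [excessError_eq_norm_sq hK ρ hfg]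
      exact ((S.continuous.comp (hdkrr.sub continuous_const)).norm.pow 2).aestronglyMeasurable
    · have h0 : 0 ≤ excessError ρ (dkrr H D fun _ => l) := integral_nonneg fun _ => sq_nonneg _
      exact (Real.norm_of_nonneg h0).trans_le (hexc D)
  refine ⟨hint, (integral_mono hint hbound hexc).trans ?_⟩
  have h6 : ∫ D, 2 * ‖V D‖ ^ 2 + 2 * ∑ j, w j * ‖B j fun i => D ⟨j, i⟩‖ ^ 2 ∂P =
      2 * ∫ D, ‖V D‖ ^ 2 ∂P + 2 * ∑ j, w j * ∫ D, ‖B j fun i => D ⟨j, i⟩‖ ^ 2 ∂P := by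
    rw [integral_add (hVi.const_mul 2) (hbi.const_mul 2), integral_const_mul, integral_const_mul,
      integral_finsetSum _ fun j _ => (hBi' j).const_mul (w j)]
    simp only [integral_const_mul]
    rfl
  have h7 : ∑ j, w j * ∫ D, ‖B j fun i => D ⟨j, i⟩‖ ^ 2 ∂P ≤
      2 * (c ^ 2 * (l * ‖f‖ ^ 2)) + 2 * (c ^ 4 * (l ^ 2 * ‖g‖ ^ 2)) := by
    refine (Finset.sum_le_sum fun j _ => mul_le_mul_of_nonneg_left (hBle j) (hw0 j)).trans
      (le_of_eq ?_)
    rw [← Finset.sum_mul, hw1, one_mul]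
  refine h6.trans_le ?_
  have h8 : 16 * M ^ 2 * c ^ 2 * T / (∑ j, n j : ℕ) =
      2 * ((2 * M) ^ 2 * (2 * c ^ 2 * T / (∑ j, n j : ℕ))) := by ring
  rw [h8]
  linarith

end Main

end DKRR

theorem corollary1
    {X : Type*} [MetricSpace X] [CompactSpace X] [MeasurableSpace X] [BorelSpace X]
    (H : Type*) [NormedAddCommGroup H] [InnerProductSpace ℝ H] [CompleteSpace H] [RKHS ℝ H X ℝ]
    (hK : Continuous (Function.uncurry (DKRR.reproducingKernel H)))
    (ρ : Measure (X × ℝ)) [IsProbabilityMeasure ρ]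
    (M : ℝ) (hM : 0 < M) (hbdd : ∀ᵐ z ∂ρ, |z.2| ≤ M)
    (r : ℝ) (hr : 1 / 2 ≤ r) (hr' : r ≤ 1)
    (hρ : Lp ℝ 2 ρ.fst)
    (hreg : DKRR.regressionFunction ρ
      =ᵐ[ρ.fst] ⇑(DKRR.spectralPow (DKRR.integralOperator ρ.fst hK) r hρ))
    (s : ℝ) (hs : 0 < s) (hs' : s ≤ 1) (C₀ : ℝ) (hC₀ : 1 ≤ C₀)
    (heff : ∀ l : ℝ, 0 < l →
      DKRR.effectiveDimension (DKRR.integralOperator ρ.fst hK) l ≤ ENNReal.ofReal (C₀ * l ^ (-s)))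
    (C₁ : ℝ) (hC₁ : 0 < C₁) :
    ∃ C₂ : ℝ, 0 < C₂ ∧
      ∀ (m : ℕ) (n : Fin m → ℕ) (N : ℕ) (l : Fin m → ℝ),
        0 < m → (∀ j, 0 < n j) → N = ∑ j, n j →
        (∀ j, (N : ℝ) ^ (1 / (2 * r + s)) * Real.log N ^ 4 ≤ n j) →
        (∀ j, l j = C₁ * (N : ℝ) ^ (-(1 / (2 * r + s)))) →
        (m : ℝ) * Real.log N ^ 4 ≤ (N : ℝ) ^ ((2 * r + s - 1) / (2 * r + s)) →
        Integrable (fun D : (Σ j : Fin m, Fin (n j)) → X × ℝ =>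
            DKRR.excessError ρ (DKRR.dkrr H D l)) (Measure.pi fun _ => ρ) ∧
          ∫ D : (Σ j : Fin m, Fin (n j)) → X × ℝ,
              DKRR.excessError ρ (DKRR.dkrr H D l) ∂(Measure.pi fun _ => ρ)
            ≤ C₂ * (N : ℝ) ^ (-(2 * r / (2 * r + s))) := by
  obtain ⟨κ, hκ0, hκ⟩ := DKRR.exists_norm_kernelSection_le hK
  set δ : ℝ := C₁ * min 1 (Real.log 2 ^ 4)
  have hδ : 0 < δ := mul_pos hC₁ (lt_min one_pos (pow_pos (Real.log_pos one_lt_two) 4))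
  set c : ℝ := 1 + κ ^ 2 / δ
  have hc0 : 0 < c := by positivity
  refine ⟨4 * (c ^ 2 * (C₁ ^ (2 * r) * ‖hρ‖ ^ 2)) + 4 * (c ^ 4 * (C₁ ^ (2 * r) * ‖hρ‖ ^ 2)) +
    16 * M ^ 2 * c ^ 2 * (C₀ * C₁ ^ (-s)), by positivity, ?_⟩
  intro m n N l hm hn hN hnj hlj _
  set α := 1 / (2 * r + s) with hα
  have h2rs : 0 < 2 * r + s := by linarith
  have hnN : ∀ j, n j ≤ N := fun j => hN ▸ Finset.single_le_sum (f := n)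
    (fun _ _ => Nat.zero_le _) (Finset.mem_univ j)
  have hNpos : (0 : ℝ) < N := Nat.cast_pos.2 ((hn ⟨0, hm⟩).trans_le (hnN _))
  set lam := C₁ * (N : ℝ) ^ (-α) with hlam
  have hlam0 : 0 < lam := mul_pos hC₁ (Real.rpow_pos_of_pos hNpos _)
  obtain rfl : l = fun _ => lam := funext hlj
  have hlampow : ∀ t : ℝ, lam ^ t = C₁ ^ t * (N : ℝ) ^ (-α * t) := fun t => by
    rw [hlam, Real.mul_rpow hC₁.le (Real.rpow_nonneg hNpos.le _), ← Real.rpow_mul hNpos.le]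
  have hc : ∀ j, 1 + κ ^ 2 / (n j * lam) ≤ c := fun j => by
    have := DKRR.le_card_mul_of_rpow_mul_log_le (hn j) (hnN j) hC₁ (hnj j)
    have h2 := div_le_div_of_nonneg_left (sq_nonneg κ) hδ this
    simp only [c]
    linarith
  obtain ⟨f, g, hfg, hf, hg⟩ := DKRR.exists_spectralPow_eq_split
    (DKRR.inclusionL2 hK ρ.fst) (DKRR.integralOperator_eq_comp_adjoint hK ρ.fst) hr hr' hlam0 hρ
  have hreg' : DKRR.regressionFunction ρ =ᵐ[ρ.fst]
      ⇑(f + (DKRR.inclusionL2 hK ρ.fst).adjoint g) := by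
    refine hreg.trans ?_
    rw [← hfg]
    exact DKRR.inclusionL2_ae_eq hK ρ.fst _
  obtain ⟨hint, hle⟩ := DKRR.integrable_and_integral_excessError_dkrr_le hK ρ hκ hbdd hlam0 hm hn
    hc f g hreg' (T := C₀ * lam ^ (-s)) (by positivity) (heff lam hlam0)
  refine ⟨hint, hle.trans ?_⟩
  rw [← hN]
  have e0 : lam ^ (2 * r) = C₁ ^ (2 * r) * (N : ℝ) ^ (-(2 * r / (2 * r + s))) := by
    rw [hlampow]; congr 2; rw [hα]; ring
  have e1 : lam * ‖f‖ ^ 2 ≤ C₁ ^ (2 * r) * (N : ℝ) ^ (-(2 * r / (2 * r + s))) * ‖hρ‖ ^ 2 := by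
    refine (mul_le_mul_of_nonneg_left hf hlam0.le).trans (le_of_eq ?_)
    rw [← e0, ← mul_assoc, mul_comm lam, ← Real.rpow_add_one hlam0.ne']
    congr 2; ring
  have e2 : lam ^ 2 * ‖g‖ ^ 2 ≤ C₁ ^ (2 * r) * (N : ℝ) ^ (-(2 * r / (2 * r + s))) * ‖hρ‖ ^ 2 := by
    refine (mul_le_mul_of_nonneg_left hg (sq_nonneg lam)).trans (le_of_eq ?_)
    rw [← e0, ← mul_assoc, ← Real.rpow_natCast lam 2, ← Real.rpow_add hlam0]
    congr 2; push_cast; ring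
  have e3 : lam ^ (-s) / N = C₁ ^ (-s) * (N : ℝ) ^ (-(2 * r / (2 * r + s))) := by
    rw [hlampow, mul_div_assoc]
    nth_rewrite 2 [← Real.rpow_one (N : ℝ)]
    rw [← Real.rpow_sub hNpos]
    congr 2
    rw [hα]; field_simp; ring
  have e4 : 16 * M ^ 2 * c ^ 2 * (C₀ * lam ^ (-s)) / N =
      16 * M ^ 2 * c ^ 2 * (C₀ * (lam ^ (-s) / N)) := by ring
  rw [e4, e3]
  have e5 := mul_le_mul_of_nonneg_left e1 (sq_nonneg c)
  have e6 := mul_le_mul_of_nonneg_left e2 (pow_nonneg hc0.le 4)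
  linarith
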